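/- Let $F$ be an algebraically closed field of characteristic $0$, and let $C$ be the split octonion algebra over $F$: the $8$-dimensional algebra of matrices $\begin{pmatrix}\alpha&u\\ v&\beta\end{pmatrix}$ with $\alpha,\beta\in F$, $u,v\in F^3$ and product $$\begin{pmatrix}\alpha&u\\ v&\beta\end{pmatrix}\begin{pmatrix}\alpha'&u'\\ v'&\beta'\end{pmatrix}=\begin{pmatrix}\alpha\alpha'-(u,v')&\alpha u'+\beta' u+v\times v'\\ \alpha' v+\beta v'+u\times u'&\beta\beta'-(v,u')\end{pmatrix},$$ where $(\cdot,\cdot)$ is the standard inner product and $\times$ the standard cross product on $F^3$. Let $e_1,e_2,u_1,u_2,u_3,v_1,v_2,v_3$ be its standard basis: $e_1,e_2$ are the diagonal matrix units, and $u_i$ (respectively $v_i$) is the matrix whose upper right (respectively lower left) entry is the $i$-th standard basis vector of $F^3$ and whose other entries are $0$. Let $\Gamma$ be a nontrivial finite abelian group with identity $e$. A $\Gamma$-grading of $C$ is a decomposition $C=\bigoplus_{\gamma\in\Gamma}C_\gamma$ into subspaces with $C_\gamma C_\delta\subseteq C_{\gamma\delta}$; its support is $\{\gamma: C_\gamma\neq0\}$.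 Two $\Gamma$-gradings $(C_\gamma)$, $(\widetilde C_\gamma)$ are isomorphic if there are an automorphism $\sigma$ of the group $\Gamma$ and an automorphism $f$ of the algebra $C$ with $f(C_\gamma)=\widetilde C_{\sigma(\gamma)}$ for all $\gamma$. Consider the following families (components that are not listed are $0$; angle brackets denote linear span over $F$). * Type 1: $g,h\in\Gamma$ with $|g|>2$, $|h|=2$ and $e,g,g^{-1},h,gh,g^{-1}h$ pairwise distinct; $C_e=\langle e_1,e_2\rangle$, $C_g=\langle u_1\rangle$, $C_{g^{-1}}=\langle v_1\rangle$, $C_h=\langle u_3,v_3\rangle$, $C_{gh}=\langle v_2\rangle$, $C_{g^{-1}h}=\langle u_2\rangle$. * Type 2: $g,h\in\Gamma$ with $|g|,|h|>2$ and $e,g,h,gh,g^{-1},h^{-1},g^{-1}h^{-1}$ pairwise distinct; $C_e=\langle e_1,e_2\rangle$, $C_g=\langle u_1\rangle$, $C_h=\langle u_2\rangle$, $C_{gh}=\langle v_3\rangle$, $C_{g^{-1}}=\langle v_1\rangle$, $C_{h^{-1}}=\langle v_2\rangle$, $C_{g^{-1}h^{-1}}=\langle u_3\rangle$. * Type 3: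 $h\in\Gamma$ with $|h|>4$; $C_e=\langle e_1,e_2\rangle$, $C_h=\langle u_2,u_3\rangle$, $C_{h^{-1}}=\langle v_2,v_3\rangle$, $C_{h^{-2}}=\langle u_1\rangle$, $C_{h^2}=\langle v_1\rangle$. * Type 4: $g\in\Gamma$ with $|g|>2$; $C_e=\langle e_1,e_2,u_1,v_1\rangle$, $C_g=\langle u_2,v_3\rangle$, $C_{g^{-1}}=\langle u_3,v_2\rangle$. * Type 5: $\Gamma\cong\mathbb Z_3$, $|g|=3$; $C_e=\langle e_1,e_2\rangle$, $C_g=\langle u_1,u_2,u_3\rangle$, $C_{g^{-1}}=\langle v_1,v_2,v_3\rangle$. * Type 6: $\Gamma\cong\mathbb Z_4$, $|g|=4$; $C_e=\langle e_1,e_2\rangle$, $C_g=\langle u_1,u_2\rangle$, $C_{g^{-1}}=\langle v_1,v_2\rangle$, $C_{g^2}=\langle u_3,v_3\rangle$. * Type 7: $\Gamma\cong\mathbb Z_2$, $|g|=2$; $C_e=\langle e_1,e_2,u_1,v_1\rangle$, $C_g=\langle u_2,v_2,u_3,v_3\rangle$. * Type 8: $\Gamma\cong\mathbb Z_2^2$,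 $|g|=|h|=2$, $g\neq h$; $C_e=\langle e_1,e_2\rangle$, $C_g=\langle u_1,v_1\rangle$, $C_h=\langle u_2,v_2\rangle$, $C_{gh}=\langle u_3,v_3\rangle$. * Type 9: $\Gamma\cong\mathbb Z_2^3$, $|g|=|h|=|k|=2$ and $e,h,g,k,gh,hk,gk,hgk$ pairwise distinct; $C_e=\langle 1\rangle$, $C_h=\langle e_2-e_1\rangle$, $C_g=\langle v_1-u_1\rangle$, $C_k=\langle v_2-u_2\rangle$, $C_{gh}=\langle u_1+v_1\rangle$, $C_{hk}=\langle u_2+v_2\rangle$, $C_{gk}=\langle u_3+v_3\rangle$, $C_{hgk}=\langle v_3-u_3\rangle$. Then: 1. each of these families is a $\Gamma$-grading of $C$; 2. every $\Gamma$-grading of $C$ whose support generates $\Gamma$ is isomorphic to one of Types 1–9 for some choice of the parameters $g,h,k$; 3. if $\Gamma$ is an elementary abelian $2$-group, then any two $\Gamma$-gradings of $C$ whose supports generate $\Gamma$ are isomorphic. -/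

import Mathlib

/-- The split octonions over `F`: the matrices `[[α, u], [v, β]]` with `α, β ∈ F` and
`u, v ∈ F³`, stored row by row as `((α, u), (v, β))`. -/
def SplitOctonion (F : Type*) : Type _ :=
  (F × (Fin 3 → F)) × ((Fin 3 → F) × F)

namespace SplitOctonion

variable {F : Type*}

/-- The matrix `[[a, u], [v, b]]`. -/
def mk (a : F) (u v : Fin 3 → F) (b : F) : SplitOctonion F := ((a, u), (v, b))

theorem exists_mk (x : SplitOctonion F) : ∃ a u v b, x = mk a u v b :=
  ⟨x.1.1, x.1.2, x.2.1, x.2.2, rfl⟩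

theorem mk_congr {a b a' b' : F} {u v u' v' : Fin 3 → F} (ha : a = a') (hu : u = u')
    (hv : v = v') (hb : b = b') : mk a u v b = mk a' u' v' b' := by
  rw [ha, hu, hv, hb]

variable [Field F]

instance : AddCommGroup (SplitOctonion F) :=
  inferInstanceAs (AddCommGroup ((F × (Fin 3 → F)) × ((Fin 3 → F) × F)))

instance : Module F (SplitOctonion F) :=
  inferInstanceAs (Module F ((F × (Fin 3 → F)) × ((Fin 3 → F) × F)))

/-- `[[α, u], [v, β]] * [[α', u'], [v', β']]` is
`[[α α' - (u, v'), α u' + β' u + v × v'], [α' v + β v' + u × u', β β' - (v, u')]]`. -/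
instance : Mul (SplitOctonion F) where
  mul x y := mk
    (x.1.1 * y.1.1 - x.1.2 ⬝ᵥ y.2.1)
    (x.1.1 • y.1.2 + y.2.2 • x.1.2 + crossProduct x.2.1 y.2.1)
    (y.1.1 • x.2.1 + x.2.2 • y.2.1 + crossProduct x.1.2 y.1.2)
    (x.2.2 * y.2.2 - x.2.1 ⬝ᵥ y.1.2)

/-- The identity matrix. -/
instance : One (SplitOctonion F) where
  one := mk 1 0 0 1

theorem mk_mul_mk (a b a' b' : F) (u v u' v' : Fin 3 → F) :
    mk a u v b * mk a' u' v' b' =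
      mk (a * a' - u ⬝ᵥ v') (a • u' + b' • u + crossProduct v v')
        (a' • v + b • v' + crossProduct u u') (b * b' - v ⬝ᵥ u') := rfl

theorem mk_add_mk (a b a' b' : F) (u v u' v' : Fin 3 → F) :
    mk a u v b + mk a' u' v' b' = mk (a + a') (u + u') (v + v') (b + b') := rfl

theorem smul_mk (c a b : F) (u v : Fin 3 → F) :
    c • mk a u v b = mk (c * a) (c • u) (c • v) (c * b) := rfl

theorem zero_eq : (0 : SplitOctonion F) = mk 0 0 0 0 := rfl

theorem one_eq : (1 : SplitOctonion F) = mk 1 0 0 1 := rfl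

instance : NonAssocRing (SplitOctonion F) where
  __ := (inferInstance : AddCommGroup (SplitOctonion F))
  left_distrib x y z := by
    obtain ⟨a, u, v, b, rfl⟩ := exists_mk x
    obtain ⟨a', u', v', b', rfl⟩ := exists_mk y
    obtain ⟨a'', u'', v'', b'', rfl⟩ := exists_mk z
    simp only [mk_add_mk, mk_mul_mk, dotProduct_add, map_add]
    apply mk_congr <;> first | ring1 | module
  right_distrib x y z := by
    obtain ⟨a, u, v, b, rfl⟩ := exists_mk x
    obtain ⟨a', u', v', b', rfl⟩ := exists_mk y
    obtain ⟨a'', u'', v'', b'', rfl⟩ := exists_mk z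
    simp only [mk_add_mk, mk_mul_mk, add_dotProduct, map_add, LinearMap.add_apply]
    apply mk_congr <;> first | ring1 | module
  zero_mul x := by
    obtain ⟨a, u, v, b, rfl⟩ := exists_mk x
    simp only [zero_eq, mk_mul_mk]
    apply mk_congr <;> simp
  mul_zero x := by
    obtain ⟨a, u, v, b, rfl⟩ := exists_mk x
    simp only [zero_eq, mk_mul_mk]
    apply mk_congr <;> simp
  one_mul x := by
    obtain ⟨a, u, v, b, rfl⟩ := exists_mk x
    simp only [one_eq, mk_mul_mk]
    apply mk_congr <;> simp
  mul_one x := by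
    obtain ⟨a, u, v, b, rfl⟩ := exists_mk x
    simp only [one_eq, mk_mul_mk]
    apply mk_congr <;> simp

instance : IsScalarTower F (SplitOctonion F) (SplitOctonion F) where
  smul_assoc c x y := by
    obtain ⟨a, u, v, b, rfl⟩ := exists_mk x
    obtain ⟨a', u', v', b', rfl⟩ := exists_mk y
    simp only [smul_eq_mul, smul_mk, mk_mul_mk, smul_dotProduct, map_smul, LinearMap.smul_apply]
    apply mk_congr <;> first | ring1 | module

instance : SMulCommClass F (SplitOctonion F) (SplitOctonion F) where
  smul_comm c x y := by
    obtain ⟨a, u, v, b, rfl⟩ := exists_mk x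
    obtain ⟨a', u', v', b', rfl⟩ := exists_mk y
    simp only [smul_eq_mul, smul_mk, mk_mul_mk, dotProduct_smul, map_smul]
    apply mk_congr <;> first | ring1 | module

variable (F)

/-! The standard basis of the split octonions; `u i`, `v i` for `i = 0, 1, 2` are the elements
usually written `u₁, u₂, u₃` and `v₁, v₂, v₃`. -/

/-- The idempotent `[[1, 0], [0, 0]]`. -/
def e₁ : SplitOctonion F := mk 1 0 0 0

/-- The idempotent `[[0, 0], [0, 1]]`. -/
def e₂ : SplitOctonion F := mk 0 0 0 1

/-- `[[0, ε], [0, 0]]` for a standard basis vector `ε`. -/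
def u (i : Fin 3) : SplitOctonion F := mk 0 (Pi.single i 1) 0 0

/-- `[[0, 0], [ε, 0]]` for a standard basis vector `ε`. -/
def v (i : Fin 3) : SplitOctonion F := mk 0 0 (Pi.single i 1) 0

/-- `u₁`. -/
abbrev u₁ : SplitOctonion F := u F 0
/-- `u₂`. -/
abbrev u₂ : SplitOctonion F := u F 1
/-- `u₃`. -/
abbrev u₃ : SplitOctonion F := u F 2
/-- `v₁`. -/
abbrev v₁ : SplitOctonion F := v F 0
/-- `v₂`. -/
abbrev v₂ : SplitOctonion F := v F 1
/-- `v₃`. -/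
abbrev v₃ : SplitOctonion F := v F 2

end SplitOctonion

section Grading

variable {F A Γ : Type*} [Field F] [NonUnitalNonAssocRing A] [Module F A] [Group Γ]

/-- `𝒜` is a `Γ`-grading of the (not necessarily associative) `F`-algebra `A`:
`A` is the direct sum of the subspaces `𝒜 γ`, and `𝒜 γ * 𝒜 δ ⊆ 𝒜 (γ * δ)`. -/
structure IsGroupGrading [DecidableEq Γ] (𝒜 : Γ → Submodule F A) : Prop where
  isInternal : DirectSum.IsInternal 𝒜
  mul_mem : ∀ (γ δ : Γ) (x y : A), x ∈ 𝒜 γ → y ∈ 𝒜 δ → x * y ∈ 𝒜 (γ * δ)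

/-- The support of a grading: the degrees of its nonzero components. -/
def gradingSupport (𝒜 : Γ → Submodule F A) : Set Γ := {γ | 𝒜 γ ≠ ⊥}

/-- Two `Γ`-gradings of `A` are isomorphic if some automorphism `σ` of the group `Γ` and some
automorphism `f` of the algebra `A` satisfy `f (𝒜 γ) = ℬ (σ γ)` for all `γ`. -/
def GradingIsomorphic (𝒜 ℬ : Γ → Submodule F A) : Prop :=
  ∃ (σ : Γ ≃* Γ) (f : A ≃ₗ[F] A), (∀ x y : A, f (x * y) = f x * f y) ∧
    ∀ γ : Γ, (𝒜 γ).map (f : A →ₗ[F] A) = ℬ (σ γ)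

/-- The family of subspaces given by a list of pairs (degree, component): the degrees that are
not listed have component zero. It is only used for lists of pairwise different degrees. -/
def ofComponents (L : List (Γ × Submodule F A)) (γ : Γ) : Submodule F A :=
  sSup {V | (γ, V) ∈ L}

end Grading

namespace SplitOctonion

open Submodule

variable {F Γ : Type*} [Field F] [CommGroup Γ]

/-- Type 1, with parameters `g` and `h`. -/
def IsType1 (𝒟 : Γ → Submodule F (SplitOctonion F)) : Prop :=
  ∃ g h : Γ, 2 < orderOf g ∧ orderOf h = 2 ∧
    [1, g, g⁻¹, h, g * h, g⁻¹ * h].Nodup ∧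
    𝒟 = ofComponents
      [(1, span F {e₁ F, e₂ F}),
       (g, span F {u₁ F}),
       (g⁻¹, span F {v₁ F}),
       (h, span F {u₃ F, v₃ F}),
       (g * h, span F {v₂ F}),
       (g⁻¹ * h, span F {u₂ F})]

/-- Type 2, with parameters `g` and `h`. -/
def IsType2 (𝒟 : Γ → Submodule F (SplitOctonion F)) : Prop :=
  ∃ g h : Γ, 2 < orderOf g ∧ 2 < orderOf h ∧
    [1, g, h, g * h, g⁻¹, h⁻¹, g⁻¹ * h⁻¹].Nodup ∧
    𝒟 = ofComponents
      [(1, span F {e₁ F, e₂ F}),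
       (g, span F {u₁ F}),
       (h, span F {u₂ F}),
       (g * h, span F {v₃ F}),
       (g⁻¹, span F {v₁ F}),
       (h⁻¹, span F {v₂ F}),
       (g⁻¹ * h⁻¹, span F {u₃ F})]

/-- Type 3, with parameter `h`. -/
def IsType3 (𝒟 : Γ → Submodule F (SplitOctonion F)) : Prop :=
  ∃ h : Γ, 4 < orderOf h ∧
    𝒟 = ofComponents
      [(1, span F {e₁ F, e₂ F}),
       (h, span F {u₂ F, u₃ F}),
       (h⁻¹, span F {v₂ F, v₃ F}),
       ((h ^ 2)⁻¹, span F {u₁ F}),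
       (h ^ 2, span F {v₁ F})]

/-- Type 4, with parameter `g`. -/
def IsType4 (𝒟 : Γ → Submodule F (SplitOctonion F)) : Prop :=
  ∃ g : Γ, 2 < orderOf g ∧
    𝒟 = ofComponents
      [(1, span F {e₁ F, e₂ F, u₁ F, v₁ F}),
       (g, span F {u₂ F, v₃ F}),
       (g⁻¹, span F {u₃ F, v₂ F})]

/-- Type 5, with parameter `g`, where `Γ = ℤ₃`. -/
def IsType5 (𝒟 : Γ → Submodule F (SplitOctonion F)) : Prop :=
  Nonempty (Γ ≃* Multiplicative (ZMod 3)) ∧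
  ∃ g : Γ, orderOf g = 3 ∧
    𝒟 = ofComponents
      [(1, span F {e₁ F, e₂ F}),
       (g, span F {u₁ F, u₂ F, u₃ F}),
       (g⁻¹, span F {v₁ F, v₂ F, v₃ F})]

/-- Type 6, with parameter `g`, where `Γ = ℤ₄`. -/
def IsType6 (𝒟 : Γ → Submodule F (SplitOctonion F)) : Prop :=
  Nonempty (Γ ≃* Multiplicative (ZMod 4)) ∧
  ∃ g : Γ, orderOf g = 4 ∧
    𝒟 = ofComponents
      [(1, span F {e₁ F, e₂ F}),
       (g, span F {u₁ F, u₂ F}),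
       (g⁻¹, span F {v₁ F, v₂ F}),
       (g ^ 2, span F {u₃ F, v₃ F})]

/-- Type 7, with parameter `g`, where `Γ = ℤ₂`. -/
def IsType7 (𝒟 : Γ → Submodule F (SplitOctonion F)) : Prop :=
  Nonempty (Γ ≃* Multiplicative (ZMod 2)) ∧
  ∃ g : Γ, orderOf g = 2 ∧
    𝒟 = ofComponents
      [(1, span F {e₁ F, e₂ F, u₁ F, v₁ F}),
       (g, span F {u₂ F, v₂ F, u₃ F, v₃ F})]

/-- Type 8, with parameters `g` and `h`, where `Γ = ℤ₂ × ℤ₂`. -/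
def IsType8 (𝒟 : Γ → Submodule F (SplitOctonion F)) : Prop :=
  Nonempty (Γ ≃* Multiplicative (ZMod 2 × ZMod 2)) ∧
  ∃ g h : Γ, orderOf g = 2 ∧ orderOf h = 2 ∧ g ≠ h ∧
    𝒟 = ofComponents
      [(1, span F {e₁ F, e₂ F}),
       (g, span F {u₁ F, v₁ F}),
       (h, span F {u₂ F, v₂ F}),
       (g * h, span F {u₃ F, v₃ F})]

/-- Type 9, with parameters `g`, `h` and `k`, where `Γ = ℤ₂ × ℤ₂ × ℤ₂`. -/
def IsType9 (𝒟 : Γ → Submodule F (SplitOctonion F)) : Prop :=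
  Nonempty (Γ ≃* Multiplicative (ZMod 2 × ZMod 2 × ZMod 2)) ∧
  ∃ g h k : Γ, orderOf g = 2 ∧ orderOf h = 2 ∧ orderOf k = 2 ∧
    [1, h, g, k, g * h, h * k, g * k, h * g * k].Nodup ∧
    𝒟 = ofComponents
      [(1, span F {1}),
       (h, span F {e₂ F - e₁ F}),
       (g, span F {v₁ F - u₁ F}),
       (k, span F {v₂ F - u₂ F}),
       (g * h, span F {u₁ F + v₁ F}),
       (h * k, span F {u₂ F + v₂ F}),
       (g * k, span F {u₃ F + v₃ F}),
       (h * g * k, span F {v₃ F - u₃ F})]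

/-- The nine explicit kinds of gradings of the split octonions. -/
def IsStandardType (𝒟 : Γ → Submodule F (SplitOctonion F)) : Prop :=
  IsType1 𝒟 ∨ IsType2 𝒟 ∨ IsType3 𝒟 ∨ IsType4 𝒟 ∨ IsType5 𝒟 ∨ IsType6 𝒟 ∨ IsType7 𝒟 ∨
    IsType8 𝒟 ∨ IsType9 𝒟

end SplitOctonion

/-! The split octonions are left alternative, satisfy x² = tr(x) x − n(x) 1, and have a
nondegenerate trace form tr(xy). In a grading the trace vanishes on components of nontrivial degree
(`tr_eq_zero`), so the component of degree γ is paired with that of degree γ⁻¹. The argument splits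
on whether the identity component contains an idempotent other than 0 and 1.

If it does, an automorphism moves the idempotent to e₁ (`exists_isAlgAut_e₁`). Multiplication by e₁
and e₂ then preserves degrees, so the upper right corner e₁Ce₂ is graded, and a homogeneous basis of
it, rescaled to determinant 1, can be moved to u₁, u₂, u₃ (`exists_isCartan`). The products uᵢuᵢ₊₁ =
vᵢ₊₂ and vᵢuᵢ = −e₂ force the degrees of the uᵢ to have product 1 and the vᵢ to have the inverse
degrees. The grading is thus determined by an unordered triple of product 1 generating Γ. A triple
containing 1 gives Types 4 and 7; otherwise one containing an involution gives Types 1, 6 and 8;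
otherwise one with a repetition gives Types 3 and 5; the rest give Type 2
(`exists_perm_isStandardType`).

If it does not, traceless elements of degree 1 square to zero, and nondegeneracy of the trace form
leaves only the scalars in that degree. Nonzero homogeneous elements then have nonzero square, the
components are lines, Γ has exponent two and the support is all of Γ, so |Γ| = 8 by dimension. Three
independent homogeneous involutions are brought to normal form, which is Type 9 (`exists_isType9`).

In exponent two the elements of order above 2 needed for Types 1–6 are missing, the orders 2, 4, 8
of Γ separate Types 7, 8, 9, and automorphisms of Γ match any two choices of parameters. -/

set_option linter.unusedSimpArgs false

/-! ### Gradings of nonassociative algebras -/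

section GradingTheory

variable {F A Γ : Type*} [Field F] [NonUnitalNonAssocRing A] [Module F A]

/-- A linear automorphism is an algebra automorphism when it is multiplicative. -/
def IsAlgAut (f : A ≃ₗ[F] A) : Prop := ∀ x y : A, f (x * y) = f x * f y

theorem IsAlgAut.symm {f : A ≃ₗ[F] A} (hf : IsAlgAut f) : IsAlgAut f.symm := fun x y => by
  apply f.injective
  rw [hf, f.apply_symm_apply, f.apply_symm_apply, f.apply_symm_apply]

theorem IsAlgAut.trans {f g : A ≃ₗ[F] A} (hf : IsAlgAut f) (hg : IsAlgAut g) :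
    IsAlgAut (f.trans g) := fun x y => by
  simp only [LinearEquiv.trans_apply, hf x y, hg (f x) (f y)]

/-- The pullback of a family of subspaces along a linear automorphism. -/
def pullback (f : A ≃ₗ[F] A) (𝒜 : Γ → Submodule F A) (γ : Γ) : Submodule F A :=
  (𝒜 γ).comap (f : A →ₗ[F] A)

theorem mem_pullback {f : A ≃ₗ[F] A} {𝒜 : Γ → Submodule F A} {γ : Γ} {x : A} :
    x ∈ pullback f 𝒜 γ ↔ f x ∈ 𝒜 γ := Iff.rfl

theorem pullback_eq_map (f : A ≃ₗ[F] A) (𝒜 : Γ → Submodule F A) (γ : Γ) :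
    pullback f 𝒜 γ = (𝒜 γ).map (f.symm : A →ₗ[F] A) := by
  ext x
  rw [mem_pullback, Submodule.mem_map]
  constructor
  · exact fun h => ⟨f x, h, f.symm_apply_apply x⟩
  · rintro ⟨y, hy, rfl⟩
    simpa using hy

/-- The family of spans of the subsets of `b` of constant degree. -/
def spanGrading {ι : Type*} (F : Type*) [Field F] [Module F A] (b : ι → A) (deg : ι → Γ) (γ : Γ) :
    Submodule F A :=
  Submodule.span F (b '' {i | deg i = γ})

theorem mem_spanGrading {ι : Type*} (b : ι → A) (deg : ι → Γ) {γ : Γ} (i : ι) (h : deg i = γ) :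
    b i ∈ spanGrading F b deg γ :=
  Submodule.subset_span ⟨i, h, rfl⟩

theorem gradingSupport_pullback (f : A ≃ₗ[F] A) (𝒜 : Γ → Submodule F A) :
    gradingSupport (pullback f 𝒜) = gradingSupport 𝒜 := by
  ext γ
  simp [gradingSupport, pullback_eq_map]

variable [CommGroup Γ]

theorem GradingIsomorphic.symm {𝒜 ℬ : Γ → Submodule F A} (h : GradingIsomorphic 𝒜 ℬ) :
    GradingIsomorphic ℬ 𝒜 := by
  obtain ⟨σ, f, hf, h⟩ := h
  refine ⟨σ.symm, f.symm, IsAlgAut.symm hf, fun γ => ?_⟩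
  have := h (σ.symm γ)
  rw [MulEquiv.apply_symm_apply] at this
  rw [← this, ← Submodule.map_comp]
  simp

theorem GradingIsomorphic.trans {𝒜 ℬ 𝒞 : Γ → Submodule F A} (h : GradingIsomorphic 𝒜 ℬ)
    (h' : GradingIsomorphic ℬ 𝒞) : GradingIsomorphic 𝒜 𝒞 := by
  obtain ⟨σ, f, hf, h⟩ := h
  obtain ⟨σ', f', hf', h'⟩ := h'
  refine ⟨σ.trans σ', f.trans f', IsAlgAut.trans hf hf', fun γ => ?_⟩
  rw [MulEquiv.trans_apply, ← h', ← h, ← Submodule.map_comp]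
  rfl

theorem gradingIsomorphic_pullback {f : A ≃ₗ[F] A} (hf : IsAlgAut f) (𝒜 : Γ → Submodule F A) :
    GradingIsomorphic 𝒜 (pullback f 𝒜) :=
  ⟨MulEquiv.refl Γ, f.symm, hf.symm, fun γ => (pullback_eq_map f 𝒜 γ).symm⟩

theorem ofComponents_map (σ : Γ ≃* Γ) (L : List (Γ × Submodule F A)) (γ : Γ) :
    ofComponents (L.map fun p => (σ p.1, p.2)) (σ γ) = ofComponents L γ := by
  simp [ofComponents]

theorem gradingIsomorphic_ofComponents (σ : Γ ≃* Γ) (L : List (Γ × Submodule F A)) :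
    GradingIsomorphic (ofComponents L) (ofComponents (L.map fun p => (σ p.1, p.2))) :=
  ⟨σ, LinearEquiv.refl F A, fun _ _ => rfl, fun γ => by
    rw [ofComponents_map]; exact Submodule.map_id _⟩

variable [DecidableEq Γ]

theorem isGroupGrading_spanGrading [IsScalarTower F A A] [SMulCommClass F A A] {ι : Type*}
    {b : ι → A} {deg : ι → Γ} (hb : LinearIndependent F b)
    (hsp : Submodule.span F (Set.range b) = ⊤)
    (hmul : ∀ i j, b i * b j ∈ spanGrading F b deg (deg i * deg j)) :
    IsGroupGrading (spanGrading F b deg) where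
  isInternal := by
    apply DirectSum.isInternal_submodule_of_iSupIndep_of_iSup_eq_top
    · intro γ
      refine Disjoint.mono_right (iSup₂_le fun δ hδ => ?_)
        (hb.disjoint_span_image (s := {i | deg i = γ}) (t := {i | deg i ≠ γ}) ?_)
      · refine Submodule.span_mono (Set.image_mono ?_)
        rintro i rfl
        exact hδ
      · exact Set.disjoint_left.2 fun i hi hi' => hi' hi
    · rw [eq_top_iff, ← hsp, Submodule.span_le]
      rintro _ ⟨i, rfl⟩
      exact Submodule.mem_iSup_of_mem (deg i) (mem_spanGrading b deg i rfl)
  mul_mem γ δ x y hx hy := by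
    unfold spanGrading at hx hy
    induction hx, hy using Submodule.span_induction₂ with
    | mem_mem x y hx hy =>
      obtain ⟨i, rfl, rfl⟩ := hx
      obtain ⟨j, rfl, rfl⟩ := hy
      exact hmul i j
    | zero_left y hy => rw [zero_mul]; exact zero_mem _
    | zero_right x hx => rw [mul_zero]; exact zero_mem _
    | add_left x y z _ _ _ h h' => rw [add_mul]; exact add_mem h h'
    | add_right x y z _ _ _ h h' => rw [mul_add]; exact add_mem h h'
    | smul_left r x y _ _ h => rw [smul_mul_assoc]; exact Submodule.smul_mem _ _ h
    | smul_right r x y _ _ h => rw [mul_smul_comm]; exact Submodule.smul_mem _ _ h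

namespace IsGroupGrading

variable {𝒜 : Γ → Submodule F A} (h : IsGroupGrading 𝒜)
include h

theorem iSupIndep : _root_.iSupIndep 𝒜 := h.isInternal.submodule_iSupIndep

theorem iSup_eq_top : ⨆ γ, 𝒜 γ = ⊤ := h.isInternal.submodule_iSup_eq_top

theorem pullback {f : A ≃ₗ[F] A} (hf : IsAlgAut f) : IsGroupGrading (pullback f 𝒜) where
  isInternal := by
    have e : _root_.pullback f 𝒜 = fun γ => Submodule.orderIsoMapComap f.symm (𝒜 γ) :=
      funext fun γ => pullback_eq_map f 𝒜 γ
    rw [e]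
    apply DirectSum.isInternal_submodule_of_iSupIndep_of_iSup_eq_top
    · exact h.iSupIndep.map_orderIso _
    · rw [← OrderIso.map_iSup, h.iSup_eq_top, OrderIso.map_top]
  mul_mem γ δ x y hx hy := by
    rw [mem_pullback] at *
    rw [hf]
    exact h.mul_mem _ _ _ _ hx hy

/-- Write x of degree γ as y + z with y in `ℬ γ` and z in the span of the other `ℬ δ`. Then z = x −
y also has degree γ, so independence of 𝒜 kills it. Identifying a grading thereby reduces to
inclusions and spanning. -/
theorem eq_of_le {ℬ : Γ → Submodule F A} (hle : ∀ γ, ℬ γ ≤ 𝒜 γ) (htop : ⨆ γ, ℬ γ = ⊤) :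
    𝒜 = ℬ := by
  funext γ
  refine le_antisymm (fun x hx => ?_) (hle γ)
  have hx' : x ∈ ℬ γ ⊔ ⨆ δ, ⨆ (_ : δ ≠ γ), ℬ δ := by
    have : ℬ γ ⊔ ⨆ δ, ⨆ (_ : δ ≠ γ), ℬ δ = ⊤ := by
      rw [eq_top_iff, ← htop]
      refine iSup_le fun δ => ?_
      by_cases hδ : δ = γ
      · rw [hδ]; exact le_sup_left
      · exact le_sup_of_le_right (le_iSup₂_of_le δ hδ le_rfl)
    rw [this]; trivial
  obtain ⟨y, hy, z, hz, rfl⟩ := Submodule.mem_sup.1 hx'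
  have hz' : z ∈ ⨆ δ, ⨆ (_ : δ ≠ γ), 𝒜 δ := iSup₂_mono (fun δ _ => hle δ) hz
  have hz'' : z ∈ 𝒜 γ := by simpa using sub_mem hx (hle γ hy)
  rw [Submodule.disjoint_def.1 (h.iSupIndep γ) z hz'' hz', add_zero]
  exact hy

/-- Degrees may repeat in `L`: the corresponding components are then added up. Hence no distinctness
has to be checked when a grading is matched with a list. -/
theorem eq_ofComponents {L : List (Γ × Submodule F A)} (hle : ∀ p ∈ L, p.2 ≤ 𝒜 p.1)
    (htop : ∀ W : Submodule F A, (∀ p ∈ L, p.2 ≤ W) → W = ⊤) : 𝒜 = ofComponents L := by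
  refine h.eq_of_le (fun γ => sSup_le fun V hV => hle _ hV) (htop _ fun p hp => ?_)
  exact le_trans (le_sSup (show p.2 ∈ {V | (p.1, V) ∈ L} from hp))
    (le_iSup (ofComponents L) p.1)

theorem eq_of_mem_of_mem {γ δ : Γ} {x : A} (hx : x ∈ 𝒜 γ) (hx' : x ∈ 𝒜 δ) (h0 : x ≠ 0) :
    γ = δ := by
  by_contra hne
  exact h0 (Submodule.disjoint_def.1 (h.iSupIndep.pairwiseDisjoint hne) x hx hx')

/-- The projection onto the homogeneous component of degree `γ`. -/
noncomputable def comp (γ : Γ) : A →ₗ[F] A :=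
  letI := h.isInternal.chooseDecomposition
  (𝒜 γ).subtype ∘ₗ DirectSum.component F Γ (fun γ => 𝒜 γ) γ ∘ₗ
    (DirectSum.decomposeLinearEquiv 𝒜 : A →ₗ[F] _)

theorem comp_mem (γ : Γ) (x : A) : h.comp γ x ∈ 𝒜 γ := by
  simp [comp]

theorem comp_of_mem {γ : Γ} {x : A} (hx : x ∈ 𝒜 γ) : h.comp γ x = x := by
  let _ := h.isInternal.chooseDecomposition
  exact DirectSum.decompose_of_mem_same 𝒜 hx

theorem comp_of_mem_ne {γ δ : Γ} {x : A} (hx : x ∈ 𝒜 γ) (hne : γ ≠ δ) : h.comp δ x = 0 := by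
  let _ := h.isInternal.chooseDecomposition
  exact DirectSum.decompose_of_mem_ne 𝒜 hx hne

@[elab_as_elim]
theorem induction_on {p : A → Prop} (x : A) (zero : p 0)
    (mem : ∀ γ, ∀ x ∈ 𝒜 γ, p x) (add : ∀ x y, p x → p y → p (x + y)) : p x := by
  have hx : x ∈ ⨆ γ, 𝒜 γ := by rw [h.iSup_eq_top]; trivial
  induction hx using Submodule.iSup_induction' with
  | mem i x hx => exact mem i x hx
  | zero => exact zero
  | add x y _ _ h h' => exact add x y h h'

theorem sum_comp [Fintype Γ] (x : A) : ∑ γ, h.comp γ x = x := by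
  induction x using h.induction_on with
  | zero => simp
  | mem γ x hx =>
    rw [Finset.sum_eq_single γ, h.comp_of_mem hx]
    · exact fun δ _ hδ => h.comp_of_mem_ne hx hδ.symm
    · simp
  | add x y hx hy => simp [Finset.sum_add_distrib, hx, hy]

theorem comp_mul_left {γ : Γ} {x : A} (hx : x ∈ 𝒜 γ) (δ : Γ) (y : A) :
    h.comp (γ * δ) (x * y) = x * h.comp δ y := by
  induction y using h.induction_on with
  | zero => simp
  | mem ε y hy =>
    by_cases hε : ε = δ
    · subst hε
      rw [h.comp_of_mem hy, h.comp_of_mem (h.mul_mem _ _ _ _ hx hy)]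
    · rw [h.comp_of_mem_ne hy hε, h.comp_of_mem_ne (h.mul_mem _ _ _ _ hx hy), mul_zero]
      simpa using hε
  | add y z hy hz => simp [mul_add, hy, hz]

theorem comp_mul_right {γ : Γ} {x : A} (hx : x ∈ 𝒜 γ) (δ : Γ) (y : A) :
    h.comp (δ * γ) (y * x) = h.comp δ y * x := by
  induction y using h.induction_on with
  | zero => simp
  | mem ε y hy =>
    by_cases hε : ε = δ
    · subst hε
      rw [h.comp_of_mem hy, h.comp_of_mem (h.mul_mem _ _ _ _ hy hx)]
    · rw [h.comp_of_mem_ne hy hε, h.comp_of_mem_ne (h.mul_mem _ _ _ _ hy hx), zero_mul]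
      simpa using hε
  | add y z hy hz => simp [add_mul, hy, hz]

end IsGroupGrading

/-- For x of degree γ, comparing components of degree γ in x · 1 = x shows that the degree 1 part of
the unit is a right identity, hence is the unit. -/
theorem IsGroupGrading.one_mem {A : Type*} [NonAssocRing A] [Module F A]
    {𝒜 : Γ → Submodule F A} (h : IsGroupGrading 𝒜) : (1 : A) ∈ 𝒜 1 := by
  have key : ∀ x : A, x * h.comp 1 1 = x := fun x => by
    induction x using h.induction_on with
    | zero => simp
    | mem γ x hx =>
      rw [← h.comp_mul_left hx, mul_one, mul_one, h.comp_of_mem hx]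
    | add x y hx hy => rw [add_mul, hx, hy]
  have := key 1
  rw [one_mul] at this
  rw [← this]
  exact h.comp_mem 1 1

end GradingTheory

/-! ### Trace, norm and explicit automorphisms of the octonions -/

namespace SplitOctonion

variable {F : Type*}

@[elab_as_elim]
theorem ind {p : SplitOctonion F → Prop}
    (h : ∀ (a : F) (u v : Fin 3 → F) (b : F), p (mk a u v b)) (x : SplitOctonion F) : p x :=
  h x.1.1 x.1.2 x.2.1 x.2.2

theorem mk_inj {a b a' b' : F} {u v u' v' : Fin 3 → F} :
    mk a u v b = mk a' u' v' b' ↔ a = a' ∧ u = u' ∧ v = v' ∧ b = b' := by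
  constructor
  · intro h
    exact ⟨congrArg (fun x => x.1.1) h, congrArg (fun x => x.1.2) h,
      congrArg (fun x => x.2.1) h, congrArg (fun x => x.2.2) h⟩
  · rintro ⟨rfl, rfl, rfl, rfl⟩; rfl

variable [Field F]

theorem cross_zero (a b : Fin 3 → F) : crossProduct a b 0 = a 1 * b 2 - a 2 * b 1 := rfl

theorem cross_one (a b : Fin 3 → F) : crossProduct a b 1 = a 2 * b 0 - a 0 * b 2 := rfl

theorem cross_two (a b : Fin 3 → F) : crossProduct a b 2 = a 0 * b 1 - a 1 * b 0 := rfl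

theorem dot_eq (a b : Fin 3 → F) : a ⬝ᵥ b = a 0 * b 0 + a 1 * b 1 + a 2 * b 2 :=
  Fin.sum_univ_three _

theorem funext_three {α : Type*} {a b : Fin 3 → α} (h0 : a 0 = b 0) (h1 : a 1 = b 1)
    (h2 : a 2 = b 2) : a = b := by
  funext i; fin_cases i <;> assumption

theorem neg_mk (a b : F) (u v : Fin 3 → F) : -mk a u v b = mk (-a) (-u) (-v) (-b) := rfl

theorem mk_sub_mk (a b a' b' : F) (u v u' v' : Fin 3 → F) :
    mk a u v b - mk a' u' v' b' = mk (a - a') (u - u') (v - v') (b - b') := rfl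

/-- The trace of an octonion. -/
def tr : SplitOctonion F →ₗ[F] F where
  toFun x := x.1.1 + x.2.2
  map_add' x y := add_add_add_comm x.1.1 y.1.1 x.2.2 y.2.2
  map_smul' c x := (mul_add c x.1.1 x.2.2).symm

/-- The norm of an octonion. -/
def nrm (x : SplitOctonion F) : F := x.1.1 * x.2.2 + x.1.2 ⬝ᵥ x.2.1

theorem tr_mk (a b : F) (u v : Fin 3 → F) : tr (mk a u v b) = a + b := rfl

theorem nrm_mk (a b : F) (u v : Fin 3 → F) : nrm (mk a u v b) = a * b + u ⬝ᵥ v := rfl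

theorem mul_self (x : SplitOctonion F) : x * x = tr x • x - nrm x • 1 := by
  induction x using ind with | h a u v b
  simp only [mk_mul_mk, tr_mk, nrm_mk, one_eq, smul_mk, mk_sub_mk, cross_self]
  apply mk_congr
  · ring
  · rw [add_smul]; simp
  · rw [add_smul]; simp
  · rw [dotProduct_comm]; ring

theorem mul_mul_self (x y : SplitOctonion F) : x * (x * y) = (x * x) * y := by
  induction x using ind with | h a u v b
  induction y using ind with | h a' u' v' b'
  simp only [mk_mul_mk]
  apply mk_congr
  · simp only [cross_zero, cross_one, cross_two, dot_eq, Pi.add_apply, Pi.smul_apply, smul_eq_mul]; ring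
  · apply funext_three <;>
        simp only [cross_zero, cross_one, cross_two, dot_eq, Pi.add_apply, Pi.smul_apply, smul_eq_mul] <;> ring
  · apply funext_three <;>
        simp only [cross_zero, cross_one, cross_two, dot_eq, Pi.add_apply, Pi.smul_apply, smul_eq_mul] <;> ring
  · simp only [cross_zero, cross_one, cross_two, dot_eq, Pi.add_apply, Pi.smul_apply, smul_eq_mul]; ring

theorem tr_mul_comm (x y : SplitOctonion F) : tr (x * y) = tr (y * x) := by
  induction x using ind with | h a u v b
  induction y using ind with | h a' u' v' b'
  simp only [mk_mul_mk, tr_mk]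
  rw [dotProduct_comm u, dotProduct_comm v]
  ring

theorem tr_one : tr (1 : SplitOctonion F) = 2 := by
  rw [one_eq, tr_mk]; norm_num

theorem eq_zero_of_tr_mul_eq_zero (x : SplitOctonion F) (h : ∀ y, tr (x * y) = 0) : x = 0 := by
  induction x using ind with | h a u v b
  rw [zero_eq]
  apply mk_congr
  · simpa [mk_mul_mk, tr_mk] using h (mk 1 0 0 0)
  · funext i; simpa [mk_mul_mk, tr_mk] using h (mk 0 0 (Pi.single i 1) 0)
  · funext i; simpa [mk_mul_mk, tr_mk] using h (mk 0 (Pi.single i 1) 0 0)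
  · simpa [mk_mul_mk, tr_mk] using h (mk 0 0 0 1)

instance : Module.Finite F (SplitOctonion F) :=
  inferInstanceAs (Module.Finite F ((F × (Fin 3 → F)) × ((Fin 3 → F) × F)))

theorem finrank_eq : Module.finrank F (SplitOctonion F) = 8 := by
  change Module.finrank F ((F × (Fin 3 → F)) × ((Fin 3 → F) × F)) = 8
  simp

instance : Nontrivial (SplitOctonion F) :=
  inferInstanceAs (Nontrivial ((F × (Fin 3 → F)) × ((Fin 3 → F) × F)))

theorem eq_top_of_basis_mem {W : Submodule F (SplitOctonion F)} (h1 : e₁ F ∈ W) (h2 : e₂ F ∈ W)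
    (hu : ∀ i, u F i ∈ W) (hv : ∀ i, v F i ∈ W) : W = ⊤ := by
  rw [eq_top_iff]
  intro x _
  induction x using ind with | h a p q b
  have : mk a p q b = a • e₁ F + b • e₂ F + ∑ i, p i • u F i + ∑ i, q i • v F i := by
    simp only [e₁, e₂, u, v, smul_mk, mk_add_mk, Fin.sum_univ_three]
    apply mk_congr
    · simp
    · funext i; fin_cases i <;> simp
    · funext i; fin_cases i <;> simp
    · simp
  rw [this]
  exact add_mem (add_mem (add_mem (W.smul_mem _ h1) (W.smul_mem _ h2))
    (sum_mem fun i _ => W.smul_mem _ (hu i))) (sum_mem fun i _ => W.smul_mem _ (hv i))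

/-- A multiplicative trace preserving linear endomorphism is an automorphism. -/
theorem exists_isAlgAut (f : SplitOctonion F →ₗ[F] SplitOctonion F)
    (hmul : ∀ x y, f (x * y) = f x * f y) (htr : ∀ x, tr (f x) = tr x) :
    ∃ g : SplitOctonion F ≃ₗ[F] SplitOctonion F, IsAlgAut g ∧ ∀ x, g x = f x := by
  -- The kernel lies in the radical of the trace form: f x = 0 gives tr(xy) = tr(f x · f y) = 0 for
  -- all y.
  have hinj : Function.Injective f := by
    rw [injective_iff_map_eq_zero]
    intro x hx
    refine eq_zero_of_tr_mul_eq_zero x fun y => ?_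
    rw [← htr, hmul, hx, zero_mul, map_zero]
  exact ⟨LinearEquiv.ofInjectiveEndo f hinj, hmul, fun x => rfl⟩

/-- The exponential of the derivation that sends `e₁` to the upper right matrix with entry `w`. -/
theorem exists_isAlgAut_exp (w : Fin 3 → F) :
    ∃ g : SplitOctonion F ≃ₗ[F] SplitOctonion F, IsAlgAut g ∧ ∀ a p q b, g (mk a p q b) =
      mk (a + w ⬝ᵥ q) (p + (a - b) • w + (w ⬝ᵥ q) • w) (q + crossProduct w p) (b - w ⬝ᵥ q) := by
  let f : SplitOctonion F →ₗ[F] SplitOctonion F :=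
    { toFun := fun x => mk (x.1.1 + w ⬝ᵥ x.2.1)
        (x.1.2 + (x.1.1 - x.2.2) • w + (w ⬝ᵥ x.2.1) • w)
        (x.2.1 + crossProduct w x.1.2) (x.2.2 - w ⬝ᵥ x.2.1)
      map_add' := fun x y => by
        induction x using ind with | h a u v b
        induction y using ind with | h a' u' v' b'
        simp only [mk_add_mk]
        simp only [mk, dotProduct_add, map_add]
        apply mk_congr <;> first | ring1 | module
      map_smul' := fun c x => by
        induction x using ind with | h a u v b
        simp only [smul_mk, RingHom.id_apply]
        simp only [mk, dotProduct_smul, map_smul, smul_eq_mul]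
        apply mk_congr <;> first | ring1 | module }
  have hf : ∀ a p q b, f (mk a p q b) = mk (a + w ⬝ᵥ q) (p + (a - b) • w + (w ⬝ᵥ q) • w)
    (q + crossProduct w p) (b - w ⬝ᵥ q) := fun _ _ _ _ => rfl
  obtain ⟨g, hg, hgf⟩ := exists_isAlgAut f (fun x y => by
    induction x using ind with | h a u v b
    induction y using ind with | h a' u' v' b'
    simp only [mk_mul_mk, hf]
    apply mk_congr
    · simp only [cross_zero, cross_one, cross_two, dot_eq, Pi.add_apply, Pi.smul_apply, smul_eq_mul]; ring
    · apply funext_three <;>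
        simp only [cross_zero, cross_one, cross_two, dot_eq, Pi.add_apply, Pi.smul_apply, smul_eq_mul] <;> ring
    · apply funext_three <;>
        simp only [cross_zero, cross_one, cross_two, dot_eq, Pi.add_apply, Pi.smul_apply, smul_eq_mul] <;> ring
    · simp only [cross_zero, cross_one, cross_two, dot_eq, Pi.add_apply, Pi.smul_apply, smul_eq_mul]; ring) (fun x => by
    induction x using ind with | h a u v b
    rw [hf, tr_mk, tr_mk]; ring)
  exact ⟨g, hg, fun a p q b => by rw [hgf, hf]⟩

theorem exists_isAlgAut_swap :
    ∃ g : SplitOctonion F ≃ₗ[F] SplitOctonion F, IsAlgAut g ∧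
      ∀ a p q b, g (mk a p q b) = mk b q p a := by
  let f : SplitOctonion F →ₗ[F] SplitOctonion F :=
    { toFun := fun x => mk x.2.2 x.2.1 x.1.2 x.1.1
      map_add' := fun x y => rfl
      map_smul' := fun c x => rfl }
  have hf : ∀ a p q b, f (mk a p q b) = mk b q p a := fun _ _ _ _ => rfl
  obtain ⟨g, hg, hgf⟩ := exists_isAlgAut f (fun x y => by
    induction x using ind with | h a u v b
    induction y using ind with | h a' u' v' b'
    simp only [mk_mul_mk, hf]
    apply mk_congr
    · ring
    · rw [add_comm (b • v')]
    · rw [add_comm (b' • u)]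
    · ring) (fun x => by
    induction x using ind with | h a u v b
    rw [hf, tr_mk, tr_mk, add_comm])
  exact ⟨g, hg, fun a p q b => by rw [hgf, hf]⟩

/-- The action of the unimodular matrix with columns `p`, `q`, `r`. -/
theorem exists_isAlgAut_unimodular (p q r : Fin 3 → F) (hdet : p ⬝ᵥ crossProduct q r = 1) :
    ∃ g : SplitOctonion F ≃ₗ[F] SplitOctonion F, IsAlgAut g ∧ ∀ a x y b, g (mk a x y b) =
      mk a (x 0 • p + x 1 • q + x 2 • r)
        (y 0 • crossProduct q r + y 1 • crossProduct r p + y 2 • crossProduct p q) b := by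
  let f : SplitOctonion F →ₗ[F] SplitOctonion F :=
    { toFun := fun x => mk x.1.1 (x.1.2 0 • p + x.1.2 1 • q + x.1.2 2 • r)
        (x.2.1 0 • crossProduct q r + x.2.1 1 • crossProduct r p + x.2.1 2 • crossProduct p q) x.2.2
      map_add' := fun x y => by
        induction x using ind with | h a u v b
        induction y using ind with | h a' u' v' b'
        simp only [mk_add_mk]
        simp only [mk, Pi.add_apply]
        apply mk_congr <;> first | rfl | module
      map_smul' := fun c x => by
        induction x using ind with | h a u v b
        simp only [smul_mk, RingHom.id_apply]
        simp only [mk, Pi.smul_apply, smul_eq_mul]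
        apply mk_congr <;> first | rfl | module }
  have hf : ∀ a x y b, f (mk a x y b) = mk a (x 0 • p + x 1 • q + x 2 • r)
        (y 0 • crossProduct q r + y 1 • crossProduct r p + y 2 • crossProduct p q) b :=
    fun _ _ _ _ => rfl
  -- The cross products are the columns of the inverse transpose of (p, q, r), so the pairing of u
  -- with v and the products v × v' are preserved up to multiples of this determinant relation.
  have hd : p 0 * (q 1 * r 2 - q 2 * r 1) + p 1 * (q 2 * r 0 - q 0 * r 2) +
      p 2 * (q 0 * r 1 - q 1 * r 0) = 1 := by
    rw [← hdet]; simp only [cross_zero, cross_one, cross_two, dot_eq, Pi.add_apply, Pi.smul_apply, smul_eq_mul]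
  obtain ⟨g, hg, hgf⟩ := exists_isAlgAut f (fun x y => by
    induction x using ind with | h a u v b
    induction y using ind with | h a' u' v' b'
    simp only [mk_mul_mk, hf]
    apply mk_congr
    · simp only [cross_zero, cross_one, cross_two, dot_eq, Pi.add_apply, Pi.smul_apply, smul_eq_mul]
      linear_combination (u 0 * v' 0 + u 1 * v' 1 + u 2 * v' 2) * hd
    · apply funext_three <;>
        simp only [cross_zero, cross_one, cross_two, dot_eq, Pi.add_apply, Pi.smul_apply, smul_eq_mul]
      · linear_combination (-(v 1 * v' 2 - v 2 * v' 1) * p 0 - (v 2 * v' 0 - v 0 * v' 2) * q 0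
          - (v 0 * v' 1 - v 1 * v' 0) * r 0) * hd
      · linear_combination (-(v 1 * v' 2 - v 2 * v' 1) * p 1 - (v 2 * v' 0 - v 0 * v' 2) * q 1
          - (v 0 * v' 1 - v 1 * v' 0) * r 1) * hd
      · linear_combination (-(v 1 * v' 2 - v 2 * v' 1) * p 2 - (v 2 * v' 0 - v 0 * v' 2) * q 2
          - (v 0 * v' 1 - v 1 * v' 0) * r 2) * hd
    · apply funext_three <;>
        simp only [cross_zero, cross_one, cross_two, dot_eq, Pi.add_apply, Pi.smul_apply, smul_eq_mul] <;> ring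
    · simp only [cross_zero, cross_one, cross_two, dot_eq, Pi.add_apply, Pi.smul_apply, smul_eq_mul]
      linear_combination (v 0 * u' 0 + v 1 * u' 1 + v 2 * u' 2) * hd) (fun x => by
    induction x using ind with | h a u v b
    rw [hf, tr_mk, tr_mk])
  exact ⟨g, hg, fun a x y b => by rw [hgf, hf]⟩

end SplitOctonion

/-! ### Idempotents and homogeneous canonical bases -/

namespace SplitOctonion

variable {F : Type*} [Field F]

/-- Two shears act like row reduction. A lower triangular one, obtained from the exponential by
conjugating with the swap, uses w = a⁻¹q to clear the bottom row; the upper triangular one with w =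
−p then clears p. -/
theorem exists_isAlgAut_map_idempotent {a b : F} {p q : Fin 3 → F} (hab : a + b = 1)
    (hpq : p ⬝ᵥ q = -(a * b)) (ha : a ≠ 0) :
    ∃ g : SplitOctonion F ≃ₗ[F] SplitOctonion F, IsAlgAut g ∧ g (mk a p q b) = e₁ F := by
  obtain ⟨s, hs, hs'⟩ := exists_isAlgAut_swap (F := F)
  obtain ⟨g, hg, hg'⟩ := exists_isAlgAut_exp (a⁻¹ • q)
  obtain ⟨k, hk, hk'⟩ := exists_isAlgAut_exp (-p)
  refine ⟨((s.trans g).trans s).trans k, ((hs.trans hg).trans hs).trans hk, ?_⟩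
  simp only [LinearEquiv.trans_apply]
  rw [hs', hg', hs']
  have hqp : (a⁻¹ • q) ⬝ᵥ p = -b := by
    rw [smul_dotProduct, dotProduct_comm, hpq, smul_eq_mul]; field_simp
  have e : mk (a - (a⁻¹ • q) ⬝ᵥ p) (p + crossProduct (a⁻¹ • q) q)
      (q + (b - a) • a⁻¹ • q + ((a⁻¹ • q) ⬝ᵥ p) • a⁻¹ • q) (b + (a⁻¹ • q) ⬝ᵥ p) =
      mk 1 p 0 0 := by
    rw [hqp]
    apply mk_congr
    · rw [sub_neg_eq_add, hab]
    · simp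
    · rw [smul_smul, smul_smul, ← one_smul F q, smul_smul, smul_smul, ← add_smul, ← add_smul]
      convert zero_smul F q using 2
      field_simp
      ring
    · ring
  rw [e, hk', e₁]
  apply mk_congr <;> simp

/-- The off-diagonal entries satisfy (a + b)p = p and (a + b)q = q. If a + b ≠ 1 both vanish, a and
b are 0 or 1, and only the trivial idempotents remain. -/
theorem eq_of_idempotent {a b : F} {p q : Fin 3 → F} (hE : mk a p q b * mk a p q b = mk a p q b)
    (h0 : mk a p q b ≠ 0) (h1 : mk a p q b ≠ 1) : a + b = 1 ∧ p ⬝ᵥ q = -(a * b) := by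
  rw [mk_mul_mk, mk_inj] at hE
  obtain ⟨ha, hp, hq, hb⟩ := hE
  rw [cross_self, add_zero, ← add_smul] at hp hq
  have hab : a + b = 1 := by
    by_contra hab
    have hz : ∀ x : Fin 3 → F, (a + b) • x = x → x = 0 := fun x hx => by
      have : (a + b - 1) • x = 0 := by rw [sub_smul, hx, one_smul, sub_self]
      exact (smul_eq_zero.1 this).resolve_left (sub_ne_zero.2 hab)
    obtain rfl := hz p hp
    obtain rfl := hz q hq
    rw [zero_dotProduct, sub_zero] at ha hb
    have ha' : a = 0 ∨ a = 1 := by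
      have : a * (a - 1) = 0 := by rw [mul_sub, ha]; ring
      exact (mul_eq_zero.1 this).imp id sub_eq_zero.1
    have hb' : b = 0 ∨ b = 1 := by
      have : b * (b - 1) = 0 := by rw [mul_sub, hb]; ring
      exact (mul_eq_zero.1 this).imp id sub_eq_zero.1
    rcases ha' with rfl | rfl <;> rcases hb' with rfl | rfl
    · exact h0 rfl
    · exact hab (zero_add 1)
    · exact hab (add_zero 1)
    · exact h1 rfl
  refine ⟨hab, ?_⟩
  linear_combination a * hab - ha

/-- Automorphisms act transitively on the nontrivial idempotents. -/
theorem exists_isAlgAut_e₁ {E : SplitOctonion F} (hE : E * E = E) (h0 : E ≠ 0) (h1 : E ≠ 1) :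
    ∃ g : SplitOctonion F ≃ₗ[F] SplitOctonion F, IsAlgAut g ∧ g (e₁ F) = E := by
  suffices ∃ g : SplitOctonion F ≃ₗ[F] SplitOctonion F, IsAlgAut g ∧ g E = e₁ F by
    obtain ⟨g, hg, hgE⟩ := this
    exact ⟨g.symm, hg.symm, by rw [← hgE, g.symm_apply_apply]⟩
  induction E using ind with | h a p q b
  obtain ⟨hab, hpq⟩ := eq_of_idempotent hE h0 h1
  by_cases ha : a = 0
  · subst ha
    obtain ⟨s, hs, hs'⟩ := exists_isAlgAut_swap (F := F)
    obtain ⟨g, hg, hg'⟩ := exists_isAlgAut_map_idempotent (a := b) (b := 0) (p := q) (q := p)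
      (by rw [add_comm, hab]) (by rw [dotProduct_comm, hpq]; ring)
      (by rintro rfl; simp at hab)
    exact ⟨s.trans g, hs.trans hg, by rw [LinearEquiv.trans_apply, hs', hg']⟩
  · exact exists_isAlgAut_map_idempotent hab hpq ha

theorem u_mul_v (i : Fin 3) : u F i * v F i = -e₁ F := by
  simp only [u, v, e₁, mk_mul_mk, neg_mk]
  apply mk_congr <;> simp

theorem v_mul_u (i : Fin 3) : v F i * u F i = -e₂ F := by
  simp only [u, v, e₂, mk_mul_mk, neg_mk]
  apply mk_congr <;> simp

theorem u_mul_u (i : Fin 3) : u F i * u F (i + 1) = v F (i + 2) := by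
  simp only [u, v, mk_mul_mk]
  apply mk_congr <;> fin_cases i <;> simp [crossProduct] <;> apply funext_three <;> simp

theorem v_mul_v (i : Fin 3) : v F i * v F (i + 1) = u F (i + 2) := by
  simp only [u, v, mk_mul_mk]
  apply mk_congr <;> fin_cases i <;> simp [crossProduct] <;> apply funext_three <;> simp

theorem e₁_add_e₂ : e₁ F + e₂ F = 1 := by
  simp only [e₁, e₂, one_eq, mk_add_mk]
  apply mk_congr <;> simp

theorem e₁_mul_mul_e₂ (a b : F) (p q : Fin 3 → F) :
    e₁ F * (mk a p q b * e₂ F) = mk 0 p 0 0 := by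
  simp only [e₁, e₂, mk_mul_mk]
  apply mk_congr <;> simp

theorem e₂_ne_zero : e₂ F ≠ 0 := fun h => one_ne_zero (α := F) (mk_inj.1 h).2.2.2

variable {Γ : Type*} [CommGroup Γ] [DecidableEq Γ] {𝒜 : Γ → Submodule F (SplitOctonion F)}

/-- The canonical basis is homogeneous, the diagonal has degree `1` and `u i` has degree `a i`. -/
structure IsCartan (𝒜 : Γ → Submodule F (SplitOctonion F)) (a : Fin 3 → Γ) : Prop where
  e₁_mem : e₁ F ∈ 𝒜 1
  e₂_mem : e₂ F ∈ 𝒜 1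
  u_mem : ∀ i, u F i ∈ 𝒜 (a i)
  v_mem : ∀ i, v F i ∈ 𝒜 (a i)⁻¹

theorem exists_homogeneous_basis (h : IsGroupGrading 𝒜) (he : e₁ F ∈ 𝒜 1) [Finite Γ] :
    ∃ (b : Fin 3 → Fin 3 → F) (a : Fin 3 → Γ),
      LinearIndependent F b ∧ ∀ i, mk 0 (b i) 0 0 ∈ 𝒜 (a i) := by
  have he₂ : e₂ F ∈ 𝒜 1 := by
    rw [show e₂ F = 1 - e₁ F by rw [← e₁_add_e₂]; abel]
    exact sub_mem h.one_mem he
  let S : Set (Fin 3 → F) := {p | ∃ γ, mk 0 p 0 0 ∈ 𝒜 γ}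
  have hS : ⊤ ≤ Submodule.span F S := by
    intro p _
    have := Fintype.ofFinite Γ
    -- Since e₁ and e₂ have degree 1, the map x ↦ e₁(x e₂) commutes with the projections to
    -- components, so each component of an upper right element is again upper right.
    have key : ∀ γ, ∃ p', h.comp γ (mk 0 p 0 0) = mk 0 p' 0 0 := fun γ => by
      obtain ⟨c, p', q, d, hx⟩ := exists_mk (h.comp γ (mk 0 p 0 0))
      refine ⟨p', ?_⟩
      have e : h.comp (1 * (γ * 1)) (e₁ F * (mk 0 p 0 0 * e₂ F)) =
          e₁ F * (h.comp γ (mk 0 p 0 0) * e₂ F) := by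
        rw [h.comp_mul_left he, h.comp_mul_right he₂]
      rw [e₁_mul_mul_e₂, mul_one, one_mul] at e
      rw [e, hx, e₁_mul_mul_e₂]
    choose c hc using key
    have hp : p = ∑ γ, c γ := by
      have := h.sum_comp (mk 0 p 0 0)
      simp only [hc] at this
      let π : SplitOctonion F →ₗ[F] (Fin 3 → F) :=
        { toFun := fun x => x.1.2, map_add' := fun _ _ => rfl, map_smul' := fun _ _ => rfl }
      have h2 := congrArg π this
      rw [map_sum] at h2
      exact h2.symm
    rw [hp]
    exact sum_mem fun γ _ => Submodule.subset_span ⟨γ, by rw [← hc]; exact h.comp_mem _ _⟩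
  let B := Module.Basis.ofSpan hS
  have hB := Module.finrank_eq_nat_card_basis B
  rw [Module.finrank_fin_fun] at hB
  have := Nat.finite_of_card_ne_zero (hB ▸ three_ne_zero)
  let b := B.reindex (Finite.equivFinOfCardEq hB.symm)
  have hbS : ∀ i, b i ∈ S := fun i => by
    rw [Module.Basis.reindex_apply]
    exact Module.Basis.ofSpan_subset hS ⟨_, rfl⟩
  choose a ha using hbS
  exact ⟨b, a, b.linearIndependent, ha⟩

/-- If `e₁` has degree `1` then, after an automorphism, the canonical basis is homogeneous, and
the degrees of the `u i` can be put in any order. -/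
theorem exists_isCartan (h : IsGroupGrading 𝒜) (he : e₁ F ∈ 𝒜 1) [Finite Γ] :
    ∃ a : Fin 3 → Γ, a 0 * a 1 * a 2 = 1 ∧ ∀ π : Equiv.Perm (Fin 3),
      ∃ g : SplitOctonion F ≃ₗ[F] SplitOctonion F, IsAlgAut g ∧
        IsCartan (pullback g 𝒜) (a ∘ π) := by
  have he₂ : e₂ F ∈ 𝒜 1 := by
    rw [show e₂ F = 1 - e₁ F by rw [← e₁_add_e₂]; abel]
    exact sub_mem h.one_mem he
  obtain ⟨b, a, hb, hba⟩ := exists_homogeneous_basis h he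
  have key : ∀ π : Equiv.Perm (Fin 3), ∃ g : SplitOctonion F ≃ₗ[F] SplitOctonion F,
      IsAlgAut g ∧ e₁ F ∈ pullback g 𝒜 1 ∧ e₂ F ∈ pullback g 𝒜 1 ∧
      ∀ i, u F i ∈ pullback g 𝒜 (a (π i)) := fun π => by
    -- The triple product is the determinant of a basis. Dividing one homogeneous vector by it makes
    -- the matrix unimodular without changing degrees; this also absorbs the sign of π, so every
    -- ordering is available.
    have hD : b (π 0) ⬝ᵥ crossProduct (b (π 1)) (b (π 2)) ≠ 0 := by
      rw [triple_product_eq_det]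
      have hli : LinearIndependent F (Matrix.of ![b (π 0), b (π 1), b (π 2)]).row := by
        convert hb.comp π π.injective using 1
        funext i
        fin_cases i <;> rfl
      rw [Matrix.linearIndependent_rows_iff_isUnit, Matrix.isUnit_iff_isUnit_det] at hli
      exact hli.ne_zero
    obtain ⟨g, hg, hg'⟩ := exists_isAlgAut_unimodular
      ((b (π 0) ⬝ᵥ crossProduct (b (π 1)) (b (π 2)))⁻¹ • b (π 0)) (b (π 1)) (b (π 2))
      (by rw [smul_dotProduct, smul_eq_mul, inv_mul_cancel₀ hD])
    refine ⟨g, hg, ?_, ?_, fun i => ?_⟩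
    · rw [mem_pullback, e₁, hg']
      simpa [e₁] using he
    · rw [mem_pullback, e₂, hg']
      simpa [e₂] using he₂
    · rw [mem_pullback, u, hg']
      fin_cases i
      · have := (𝒜 (a (π 0))).smul_mem
          (b (π 0) ⬝ᵥ crossProduct (b (π 1)) (b (π 2)))⁻¹ (hba (π 0))
        simpa [smul_mk] using this
      · simpa using hba (π 1)
      · simpa using hba (π 2)
  -- The element (u₁u₂)u₃ = v₃u₃ = −e₂ has both degree a₀a₁a₂ and degree 1.
  have hprod : a 0 * a 1 * a 2 = 1 := by
    obtain ⟨g, hg, h₁, h₂, hu⟩ := key 1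
    refine (h.pullback hg).eq_of_mem_of_mem ?_ h₂ e₂_ne_zero
    have := (h.pullback hg).mul_mem _ _ _ _ ((h.pullback hg).mul_mem _ _ _ _ (hu 0) (hu 1)) (hu 2)
    rw [show u F 0 * u F 1 = v F 2 from u_mul_u 0, v_mul_u] at this
    simpa using this
  refine ⟨a, hprod, fun π => ?_⟩
  obtain ⟨g, hg, h₁, h₂, hu⟩ := key π
  refine ⟨g, hg, h₁, h₂, hu, fun i => ?_⟩
  have hπ : a (π (i + 1)) * a (π (i + 2)) * a (π i) = 1 := by
    rw [← hprod, ← Fin.prod_univ_three, ← Equiv.prod_comp π, Fin.prod_univ_three]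
    fin_cases i
    · change a (π 1) * a (π 2) * a (π 0) = a (π 0) * a (π 1) * a (π 2)
      rw [mul_comm, mul_assoc]
    · change a (π 2) * a (π 0) * a (π 1) = a (π 0) * a (π 1) * a (π 2)
      rw [mul_assoc, mul_comm]
    · rfl
  have := (h.pullback hg).mul_mem _ _ _ _ (hu (i + 1)) (hu (i + 1 + 1))
  rw [u_mul_u] at this
  rw [show i + 1 + 1 = i + 2 by rw [add_assoc]; rfl,
    show i + 1 + 2 = i by rw [add_assoc]; exact add_zero i, eq_inv_of_mul_eq_one_left hπ] at this
  exact this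

end SplitOctonion

/-! ### Independent generators in groups of exponent two -/

section ElementaryAbelian

variable {Γ : Type*} [CommGroup Γ]

/-- The homomorphism from the group with two elements with value `g` at the generator. -/
def zmodTwoHom (g : Γ) (hg : g * g = 1) : Multiplicative (ZMod 2) →* Γ where
  toFun x := if x.toAdd = 0 then 1 else g
  map_one' := by simp
  map_mul' x y := by
    induction x with | ofAdd x
    induction y with | ofAdd y
    rw [← ofAdd_add, toAdd_ofAdd, toAdd_ofAdd, toAdd_ofAdd]
    have h2 : ∀ z : ZMod 2, z = 0 ∨ z = 1 := by decide
    have h11 : (1 + 1 : ZMod 2) = 0 := by decide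
    rcases h2 x with rfl | rfl <;> rcases h2 y with rfl | rfl <;> simp [hg, h11]

theorem zmodTwoHom_apply (g : Γ) (hg : g * g = 1) (x : ZMod 2) :
    zmodTwoHom g hg (Multiplicative.ofAdd x) = if x = 0 then 1 else g := rfl

theorem nodup_of_exponent_two (hΓ : ∀ γ : Γ, γ * γ = 1) {g h k : Γ} (h1 : h ≠ 1) (g1 : g ≠ 1)
    (gh : g ≠ h) (k1 : k ≠ 1) (kh : k ≠ h) (kg : k ≠ g) (kgh : k ≠ g * h) :
    [1, h, g, k, g * h, h * k, g * k, h * g * k].Nodup := by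
  have hh := hΓ h
  have hg := hΓ g
  have hk := hΓ k
  simp only [List.nodup_cons, List.mem_cons, List.not_mem_nil, not_or, or_false, not_false_eq_true,
    List.nodup_nil, and_true]
  repeat' apply And.intro
  all_goals first | trivial | (intro e; grind)

theorem exists_generators_of_card_eq_eight (hc : Nat.card Γ = 8) (hΓ : ∀ γ : Γ, γ * γ = 1) :
    ∃ g h k : Γ, [1, h, g, k, g * h, h * k, g * k, h * g * k].Nodup := by
  classical
  have := Nat.finite_of_card_ne_zero (α := Γ) (by omega)
  have := Fintype.ofFinite Γ
  rw [Nat.card_eq_fintype_card] at hc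
  have key : ∀ s : Finset Γ, s.card < 8 → ∃ x, x ∉ s := fun s hs => by
    by_contra! hall
    rw [Finset.eq_univ_of_forall hall, Finset.card_univ] at hs
    omega
  -- Each generator is taken outside the subgroup generated by the previous ones, which has at most
  -- 1, 2 and 4 elements in turn.
  obtain ⟨h, hh⟩ := key {1} (by simp)
  obtain ⟨g, hg⟩ := key {1, h} (Finset.card_le_two.trans_lt (by norm_num))
  obtain ⟨k, hk⟩ := key {1, h, g, g * h} (Finset.card_le_four.trans_lt (by norm_num))
  simp only [Finset.mem_insert, Finset.mem_singleton, not_or] at hh hg hk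
  exact ⟨g, h, k, nodup_of_exponent_two hΓ hh hg.1 hg.2 hk.1 hk.2.1 hk.2.2.1 hk.2.2.2⟩

end ElementaryAbelian

/-! ### Gradings whose identity component consists of scalars -/

namespace SplitOctonion

variable {F : Type*} [Field F]

/-- The element (1 − a)/2 is an idempotent of trace 1, whereas 0 and 1 have traces 0 and 2. An
automorphism taking e₁ to it takes e₂ − e₁ = 1 − 2e₁ to a. -/
theorem exists_isAlgAut_involution [CharZero F] {a : SplitOctonion F} (ha : a * a = 1)
    (htr : tr a = 0) :
    ∃ g : SplitOctonion F ≃ₗ[F] SplitOctonion F, IsAlgAut g ∧ g (e₂ F - e₁ F) = a := by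
  have h2 : (2 : F) ≠ 0 := two_ne_zero
  have hE : tr ((2⁻¹ : F) • (1 - a)) = 1 := by
    rw [map_smul, map_sub, htr, tr_one, sub_zero, smul_eq_mul, inv_mul_cancel₀ h2]
  obtain ⟨g, hg, hge⟩ := exists_isAlgAut_e₁ (E := (2⁻¹ : F) • (1 - a))
    (by
      have : (1 - a) * (1 - a) = (2 : F) • (1 - a) := by
        rw [mul_sub, sub_mul, sub_mul, ha, mul_one, mul_one, one_mul, two_smul]; abel
      rw [smul_mul_smul_comm, this, smul_smul]
      congr 1
      field_simp)
    (fun h => by rw [h, map_zero] at hE; exact zero_ne_one hE)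
    (fun h => by rw [h, tr_one] at hE; norm_num at hE)
  have h1 : g 1 = 1 := by
    have := hg (g.symm 1) 1
    rwa [mul_one, g.apply_symm_apply, one_mul, eq_comm] at this
  refine ⟨g, hg, ?_⟩
  rw [show e₂ F - e₁ F = 1 - (2 : F) • e₁ F by rw [← e₁_add_e₂, two_smul]; abel, map_sub, map_smul,
    hge, h1, smul_smul, mul_inv_cancel₀ h2, one_smul, sub_sub_cancel]

theorem exists_smul_mul_self_eq_one [IsAlgClosed F] {x : SplitOctonion F} (ht : tr x = 0)
    (hn : nrm x ≠ 0) : ∃ c : F, (c • x) * (c • x) = 1 := by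
  obtain ⟨c, hc⟩ := IsAlgClosed.exists_eq_mul_self (-nrm x)⁻¹
  refine ⟨c, ?_⟩
  rw [smul_mul_smul_comm, mul_self, ht, ← hc, zero_smul, zero_sub, ← neg_smul, smul_smul,
    inv_mul_cancel₀ (neg_ne_zero.2 hn), one_smul]

/-- By left alternativity 0 = x(xy) = x²y = −n(x)y. -/
theorem eq_zero_of_mul_eq_zero {x y : SplitOctonion F} (hx : tr x = 0) (hn : nrm x ≠ 0)
    (h : x * y = 0) : y = 0 := by
  have := mul_mul_self x y
  rw [h, mul_zero, mul_self, hx, zero_smul, zero_sub, ← neg_smul, smul_mul_assoc, one_mul] at this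
  exact (smul_eq_zero.1 this.symm).resolve_left (neg_ne_zero.2 hn)

variable {Γ : Type*} [CommGroup Γ] [DecidableEq Γ] {𝒜 : Γ → Submodule F (SplitOctonion F)}

/-- In x² = tr(x)x − n(x)1 the outer terms have degrees γ² and 1, both different from γ, so tr(x)x =
0. -/
theorem tr_eq_zero (h : IsGroupGrading 𝒜) {γ : Γ} (hγ : γ ≠ 1) {x : SplitOctonion F}
    (hx : x ∈ 𝒜 γ) : tr x = 0 := by
  have e := congrArg (h.comp γ) (mul_self x)
  rw [h.comp_of_mem_ne (h.mul_mem _ _ _ _ hx hx) (by simpa using hγ), map_sub, map_smul, map_smul,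
    h.comp_of_mem hx, h.comp_of_mem_ne h.one_mem hγ.symm, smul_zero, sub_zero, eq_comm,
    smul_eq_zero] at e
  rcases e with e | e
  · exact e
  · rw [e, map_zero]

theorem tr_mul_comp (h : IsGroupGrading 𝒜) {γ : Γ} {x : SplitOctonion F}
    (hx : x ∈ 𝒜 γ) (y : SplitOctonion F) : tr (x * h.comp γ⁻¹ y) = tr (x * y) := by
  induction y using h.induction_on with
  | zero => simp
  | mem δ y hy =>
    by_cases hδ : δ = γ⁻¹
    · subst hδ; rw [h.comp_of_mem hy]
    · rw [h.comp_of_mem_ne hy hδ, mul_zero, map_zero,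
        tr_eq_zero h (fun e => hδ (eq_inv_of_mul_eq_one_right e)) (h.mul_mem _ _ _ _ hx hy)]
  | add y z hy hz => rw [map_add, mul_add, mul_add, map_add, map_add, hy, hz]

theorem exists_tr_mul_ne_zero (h : IsGroupGrading 𝒜) {γ : Γ} {x : SplitOctonion F}
    (hx : x ∈ 𝒜 γ) (h0 : x ≠ 0) : ∃ y ∈ 𝒜 γ⁻¹, tr (x * y) ≠ 0 := by
  by_contra! hc
  exact h0 (eq_zero_of_tr_mul_eq_zero x fun y => by
    rw [← tr_mul_comp h hx]; exact hc _ (h.comp_mem _ _))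

/-- If the identity component has no nontrivial idempotent, it is spanned by `1`. -/
theorem eq_zero_of_no_idempotent [IsAlgClosed F] [CharZero F] (h : IsGroupGrading 𝒜)
    (hno : ∀ f : SplitOctonion F ≃ₗ[F] SplitOctonion F, IsAlgAut f → e₁ F ∉ pullback f 𝒜 1)
    {x : SplitOctonion F} (hx : x ∈ 𝒜 1) (ht : tr x = 0) : x = 0 := by
  -- A traceless y with y² ≠ 0 rescales to an involution a of degree 1, and (1 − a)/2 would be an
  -- excluded idempotent.
  have hsq : ∀ y ∈ 𝒜 1, tr y = 0 → y * y = 0 := fun y hy hty => by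
    by_contra hne
    have hn : nrm y ≠ 0 := fun hn => hne (by rw [mul_self, hty, hn]; simp)
    obtain ⟨c, hc⟩ := exists_smul_mul_self_eq_one hty hn
    obtain ⟨g, hg, hge⟩ := exists_isAlgAut_involution hc (by rw [map_smul, hty, smul_zero])
    refine hno g hg ?_
    have h1 : (1 : SplitOctonion F) ∈ pullback g 𝒜 1 := (h.pullback hg).one_mem
    have h2 : e₂ F - e₁ F ∈ pullback g 𝒜 1 := by
      rw [mem_pullback, hge]; exact (𝒜 1).smul_mem c hy
    have : e₁ F = (2⁻¹ : F) • (1 - (e₂ F - e₁ F)) := by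
      rw [← e₁_add_e₂, show e₁ F + e₂ F - (e₂ F - e₁ F) = (2 : F) • e₁ F by rw [two_smul]; abel,
        smul_smul, inv_mul_cancel₀ two_ne_zero, one_smul]
    rw [this]
    exact Submodule.smul_mem _ _ (sub_mem h1 h2)
  by_contra h0
  obtain ⟨y, hy, hxy⟩ := exists_tr_mul_ne_zero h hx h0
  rw [inv_one] at hy
  -- The traceless part z of y has the same pairing with x because tr x = 0. Expanding (x + z)² = 0
  -- gives xz + zx = 0, whence tr(xz) = 0.
  have hz : y - (2⁻¹ * tr y) • 1 ∈ 𝒜 1 := sub_mem hy ((𝒜 1).smul_mem _ h.one_mem)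
  have htz : tr (y - (2⁻¹ * tr y) • 1) = 0 := by
    rw [map_sub, map_smul, tr_one, smul_eq_mul]; field_simp; simp
  set z := y - (2⁻¹ * tr y) • 1 with hzdef
  have hxz : tr (x * z) = tr (x * y) := by
    rw [hzdef, mul_sub, mul_smul_comm, mul_one, map_sub, map_smul, ht, smul_zero, sub_zero]
  have e := hsq (x + z) (add_mem hx hz) (by rw [map_add, ht, htz, add_zero])
  rw [mul_add, add_mul, add_mul, hsq x hx ht, hsq z hz htz, zero_add, add_zero] at e
  have e' := congrArg tr e
  rw [map_add, tr_mul_comm z x, hxz, map_zero, ← two_mul] at e'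
  exact hxy ((mul_eq_zero.1 e').resolve_left two_ne_zero)

section Division

variable [CharZero F] (h : IsGroupGrading 𝒜) (hone : ∀ x ∈ 𝒜 1, tr x = 0 → x = 0)
include h hone

theorem eq_smul_one {x : SplitOctonion F} (hx : x ∈ 𝒜 1) : x = (2⁻¹ * tr x) • 1 := by
  refine sub_eq_zero.1 (hone _ (sub_mem hx ((𝒜 1).smul_mem _ h.one_mem)) ?_)
  rw [map_sub, map_smul, tr_one, smul_eq_mul]; field_simp; simp

/-- Some y of degree γ⁻¹ makes xy a nonzero scalar. If n(x) = 0 then x² = 0, so x(xy) = x²y = 0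
would make x vanish. -/
theorem nrm_ne_zero {γ : Γ} (hγ : γ ≠ 1) {x : SplitOctonion F} (hx : x ∈ 𝒜 γ) (h0 : x ≠ 0) :
    nrm x ≠ 0 := by
  intro hn
  obtain ⟨y, hy, hxy⟩ := exists_tr_mul_ne_zero h hx h0
  have hm := h.mul_mem _ _ _ _ hx hy
  rw [mul_inv_cancel] at hm
  have e := mul_mul_self x y
  rw [eq_smul_one h hone hm, mul_self, tr_eq_zero h hγ hx, hn, zero_smul, zero_smul, sub_self,
    zero_mul, mul_smul_comm, mul_one, smul_eq_zero] at e
  rcases e with e | e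
  · exact mul_ne_zero (inv_ne_zero two_ne_zero) hxy e
  · exact h0 e

theorem mul_ne_zero_of_mem {γ : Γ} {x y : SplitOctonion F} (hx : x ∈ 𝒜 γ) (h0 : x ≠ 0)
    (hy : y ≠ 0) : x * y ≠ 0 := by
  intro e
  by_cases hγ : γ = 1
  · subst hγ
    rw [eq_smul_one h hone hx, smul_mul_assoc, one_mul, smul_eq_zero] at e
    rcases e with e | e
    · apply h0; rw [eq_smul_one h hone hx, e, zero_smul]
    · exact hy e
  · exact hy (eq_zero_of_mul_eq_zero (tr_eq_zero h hγ hx) (nrm_ne_zero h hone hγ hx h0) e)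

/-- For γ ≠ 1 the square of x is a nonzero scalar, so it has degree 1 as well as γ². -/
theorem mul_self_eq_one_of_mem {γ : Γ} {x : SplitOctonion F} (hx : x ∈ 𝒜 γ) (h0 : x ≠ 0) :
    γ * γ = 1 := by
  by_cases hγ : γ = 1
  · rw [hγ, mul_one]
  · have hm := h.mul_mem _ _ _ _ hx hx
    refine h.eq_of_mem_of_mem hm ?_ (mul_ne_zero_of_mem h hone hx h0 h0)
    rw [mul_self, tr_eq_zero h hγ hx, zero_smul, zero_sub]
    exact neg_mem ((𝒜 1).smul_mem _ h.one_mem)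

/-- Since γ² = 1, the product xy is a scalar, and x(xy) = −n(x)y recovers y as a multiple of x.
Components are therefore at most one-dimensional. -/
theorem exists_eq_smul {γ : Γ} {x y : SplitOctonion F} (hx : x ∈ 𝒜 γ) (h0 : x ≠ 0)
    (hy : y ∈ 𝒜 γ) : ∃ c : F, y = c • x := by
  by_cases hγ : γ = 1
  · subst hγ
    have hx' := eq_smul_one h hone hx
    have hc : 2⁻¹ * tr x ≠ 0 := fun hc => h0 (by rw [hx', hc, zero_smul])
    refine ⟨2⁻¹ * tr y * (2⁻¹ * tr x)⁻¹, ?_⟩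
    have hx1 : (1 : SplitOctonion F) = (2⁻¹ * tr x)⁻¹ • x := by
      conv_rhs => rw [hx', smul_smul]
      rw [← hx', inv_mul_cancel₀ hc, one_smul]
    rw [mul_smul, ← hx1]
    exact eq_smul_one h hone hy
  · have hn := nrm_ne_zero h hone hγ hx h0
    have hm := h.mul_mem _ _ _ _ hx hy
    rw [mul_self_eq_one_of_mem h hone hx h0] at hm
    have e := mul_mul_self x y
    rw [eq_smul_one h hone hm, mul_self, tr_eq_zero h hγ hx, zero_smul, zero_sub, ← neg_smul,
      smul_mul_assoc, one_mul, mul_smul_comm, mul_one] at e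
    refine ⟨(-nrm x)⁻¹ * (2⁻¹ * tr (x * y)), ?_⟩
    rw [mul_smul, e, smul_smul, inv_mul_cancel₀ (neg_ne_zero.2 hn), one_smul]

theorem exists_ne_zero_of_closure (hs : Subgroup.closure (gradingSupport 𝒜) = ⊤) (γ : Γ) :
    ∃ x ∈ 𝒜 γ, x ≠ 0 := by
  have hγ : γ ∈ Subgroup.closure (gradingSupport 𝒜) := by rw [hs]; trivial
  induction hγ using Subgroup.closure_induction with
  | mem γ hγ => exact Submodule.exists_mem_ne_zero_of_ne_bot hγ
  | one => exact ⟨1, h.one_mem, one_ne_zero⟩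
  | mul γ δ _ _ hx hy =>
    obtain ⟨x, hx, hx0⟩ := hx
    obtain ⟨y, hy, hy0⟩ := hy
    exact ⟨x * y, h.mul_mem _ _ _ _ hx hy, mul_ne_zero_of_mem h hone hx hx0 hy0⟩
  | inv γ _ hx =>
    obtain ⟨x, hx, hx0⟩ := hx
    rw [inv_eq_of_mul_eq_one_left (mul_self_eq_one_of_mem h hone hx hx0)]
    exact ⟨x, hx, hx0⟩

/-- One nonzero vector from each component gives a basis indexed by Γ of an algebra of dimension 8.
-/
theorem card_eq_eight [Finite Γ] (hs : Subgroup.closure (gradingSupport 𝒜) = ⊤) :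
    Nat.card Γ = 8 := by
  have := Fintype.ofFinite Γ
  choose x hx hx0 using exists_ne_zero_of_closure h hone hs
  have hli : LinearIndependent F x :=
    h.iSupIndep.linearIndependent 𝒜 hx hx0
  have hsp : ⊤ ≤ Submodule.span F (Set.range x) := by
    rw [← h.iSup_eq_top]
    refine iSup_le fun γ y hy => ?_
    obtain ⟨c, rfl⟩ := exists_eq_smul h hone (hx γ) (hx0 γ) hy
    exact Submodule.smul_mem _ _ (Submodule.subset_span ⟨γ, rfl⟩)
  rw [← Module.finrank_eq_nat_card_basis (Module.Basis.mk hli hsp), finrank_eq]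

end Division

end SplitOctonion

/-! ### Coordinates on elementary abelian groups of order 4 and 8 -/

section ElementaryAbelian

variable {Γ : Type*} [CommGroup Γ]

/-- The homomorphism from `ℤ₂³` with prescribed values at the generators. -/
def cubeHom (hΓ : ∀ γ : Γ, γ * γ = 1) (g h k : Γ) :
    Multiplicative (ZMod 2 × ZMod 2 × ZMod 2) →* Γ where
  toFun x := zmodTwoHom g (hΓ g) (.ofAdd x.toAdd.1) * zmodTwoHom h (hΓ h) (.ofAdd x.toAdd.2.1) *
    zmodTwoHom k (hΓ k) (.ofAdd x.toAdd.2.2)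
  map_one' := by simp [zmodTwoHom_apply]
  map_mul' x y := by
    simp only [toAdd_mul, Prod.fst_add, Prod.snd_add, ofAdd_add, map_mul]
    ac_rfl

theorem cubeHom_injective (hΓ : ∀ γ : Γ, γ * γ = 1) {g h k : Γ}
    (hn : [1, h, g, k, g * h, h * k, g * k, h * g * k].Nodup) :
    Function.Injective (cubeHom hΓ g h k) := by
  rw [injective_iff_map_eq_one]
  intro x hx
  induction x with | ofAdd x
  obtain ⟨a, b, c⟩ := x
  have h2 : ∀ z : ZMod 2, z = 0 ∨ z = 1 := by decide
  simp only [List.nodup_cons, List.mem_cons, List.not_mem_nil, not_or] at hn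
  obtain ⟨⟨h1, h3, h4, h5, h6, h7, h8, -⟩, -⟩ := hn
  rw [mul_comm h g] at h8
  rcases h2 a with rfl | rfl <;> rcases h2 b with rfl | rfl <;> rcases h2 c with rfl | rfl <;>
    simp [cubeHom, zmodTwoHom_apply] at hx
  · rfl
  · exact absurd hx.symm h4
  · exact absurd hx.symm h1
  · exact absurd hx.symm h6
  · exact absurd hx.symm h3
  · exact absurd hx.symm h7
  · exact absurd hx.symm h5
  · exact absurd hx.symm h8

theorem exists_cubeEquiv (hΓ : ∀ γ : Γ, γ * γ = 1) (hc : Nat.card Γ = 8) {g h k : Γ}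
    (hn : [1, h, g, k, g * h, h * k, g * k, h * g * k].Nodup) :
    ∃ φ : Multiplicative (ZMod 2 × ZMod 2 × ZMod 2) ≃* Γ, φ (.ofAdd (1, 0, 0)) = g ∧
      φ (.ofAdd (0, 1, 0)) = h ∧ φ (.ofAdd (0, 0, 1)) = k := by
  have hb : Function.Bijective (cubeHom hΓ g h k) := by
    have := Nat.finite_of_card_ne_zero (α := Γ) (by omega)
    rw [Nat.bijective_iff_injective_and_card]
    refine ⟨cubeHom_injective hΓ hn, ?_⟩
    rw [hc, Nat.card_congr Multiplicative.toAdd]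
    simp
  refine ⟨MulEquiv.ofBijective _ hb, ?_, ?_, ?_⟩ <;>
    simp [cubeHom, zmodTwoHom_apply]

/-- The homomorphism from `ℤ₂²` with prescribed values at the generators. -/
def squareHom (hΓ : ∀ γ : Γ, γ * γ = 1) (g h : Γ) : Multiplicative (ZMod 2 × ZMod 2) →* Γ where
  toFun x := zmodTwoHom g (hΓ g) (.ofAdd x.toAdd.1) * zmodTwoHom h (hΓ h) (.ofAdd x.toAdd.2)
  map_one' := by simp [zmodTwoHom_apply]
  map_mul' x y := by
    simp only [toAdd_mul, Prod.fst_add, Prod.snd_add, ofAdd_add, map_mul]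
    rw [mul_mul_mul_comm]

theorem squareHom_injective (hΓ : ∀ γ : Γ, γ * γ = 1) {g h : Γ} (hg : g ≠ 1) (hh : h ≠ 1)
    (hgh : g ≠ h) : Function.Injective (squareHom hΓ g h) := by
  rw [injective_iff_map_eq_one]
  intro x hx
  induction x with | ofAdd x
  obtain ⟨a, b⟩ := x
  have h2 : ∀ z : ZMod 2, z = 0 ∨ z = 1 := by decide
  rcases h2 a with rfl | rfl <;> rcases h2 b with rfl | rfl <;>
    simp [squareHom, zmodTwoHom_apply] at hx
  · rfl
  · exact absurd hx hh
  · exact absurd hx hg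
  · exact absurd ((eq_inv_of_mul_eq_one_left hx).trans (inv_eq_of_mul_eq_one_left (hΓ h))) hgh

theorem exists_squareEquiv (hΓ : ∀ γ : Γ, γ * γ = 1) {g h : Γ}
    (hb : Function.Bijective (squareHom hΓ g h)) :
    ∃ φ : Multiplicative (ZMod 2 × ZMod 2) ≃* Γ, φ (.ofAdd (1, 0)) = g ∧ φ (.ofAdd (0, 1)) = h :=
  ⟨MulEquiv.ofBijective _ hb, by simp [squareHom, zmodTwoHom_apply],
    by simp [squareHom, zmodTwoHom_apply]⟩

theorem squareHom_surjective (hΓ : ∀ γ : Γ, γ * γ = 1) {g h : Γ}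
    (hs : Subgroup.closure {g, h} = ⊤) : Function.Surjective (squareHom hΓ g h) := by
  rw [← MonoidHom.range_eq_top, eq_top_iff, ← hs, Subgroup.closure_le]
  rintro x (rfl | rfl)
  · exact ⟨.ofAdd (1, 0), by simp [squareHom, zmodTwoHom_apply]⟩
  · exact ⟨.ofAdd (0, 1), by simp [squareHom, zmodTwoHom_apply]⟩

end ElementaryAbelian

/-! ### Normal form of the ℤ₂³-grading -/

namespace SplitOctonion

variable {F : Type*} [Field F]

theorem cross_cross_eq (a b c : Fin 3 → F) :
    crossProduct a (crossProduct b c) = (a ⬝ᵥ c) • b - (a ⬝ᵥ b) • c := by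
  apply funext_three <;>
    simp only [cross_zero, cross_one, cross_two, dot_eq, Pi.sub_apply, Pi.smul_apply,
      smul_eq_mul] <;> ring

theorem e_mul_sub (i : Fin 3) : (e₂ F - e₁ F) * (v F i - u F i) = u F i + v F i := by
  simp only [e₁, e₂, u, v, mk_sub_mk, mk_mul_mk, mk_add_mk]
  apply mk_congr <;> simp

theorem e_mul_add (i : Fin 3) : (e₂ F - e₁ F) * (u F i + v F i) = v F i - u F i := by
  simp only [e₁, e₂, u, v, mk_sub_mk, mk_mul_mk, mk_add_mk]
  apply mk_congr <;> simp

theorem sub_mul_sub : (v₁ F - u₁ F) * (v₂ F - u₂ F) = u₃ F + v₃ F := by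
  simp only [u, v, mk_sub_mk, mk_mul_mk, mk_add_mk]
  apply mk_congr <;> simp [crossProduct] <;> apply funext_three <;> simp

theorem eq_top_of_mem_of_two_ne_zero (h2 : (2 : F) ≠ 0) {W : Submodule F (SplitOctonion F)}
    (h1 : 1 ∈ W) (he : e₂ F - e₁ F ∈ W) (hs : ∀ i, v F i - u F i ∈ W)
    (ha : ∀ i, u F i + v F i ∈ W) : W = ⊤ := by
  have key : ∀ x y : SplitOctonion F, x + y ∈ W → y - x ∈ W → x ∈ W ∧ y ∈ W := by
    intro x y hxy hyx
    have hx : x = (2⁻¹ : F) • ((x + y) - (y - x)) := by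
      rw [show (x + y) - (y - x) = (2 : F) • x by rw [two_smul]; abel, smul_smul,
        inv_mul_cancel₀ h2, one_smul]
    have hx' : x ∈ W := by rw [hx]; exact W.smul_mem _ (sub_mem hxy hyx)
    exact ⟨hx', by simpa using add_mem hyx hx'⟩
  have he' := key (e₁ F) (e₂ F) (by rwa [e₁_add_e₂]) he
  exact eq_top_of_basis_mem he'.1 he'.2 (fun i => (key _ _ (ha i) (hs i)).1)
    (fun i => (key _ _ (ha i) (hs i)).2)

variable {Γ : Type*} [CommGroup Γ] [DecidableEq Γ] {𝒜 : Γ → Submodule F (SplitOctonion F)}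

/-- The degrees of three generators determine the `ℤ₂³`-grading. -/
theorem eq_ofComponents_of_mem (h2 : (2 : F) ≠ 0) (h𝒜 : IsGroupGrading 𝒜) {g h k : Γ}
    (he : e₂ F - e₁ F ∈ 𝒜 h) (h1 : v₁ F - u₁ F ∈ 𝒜 g) (hk : v₂ F - u₂ F ∈ 𝒜 k) :
    𝒜 = ofComponents
      [(1, Submodule.span F {1}),
       (h, Submodule.span F {e₂ F - e₁ F}),
       (g, Submodule.span F {v₁ F - u₁ F}),
       (k, Submodule.span F {v₂ F - u₂ F}),
       (g * h, Submodule.span F {u₁ F + v₁ F}),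
       (h * k, Submodule.span F {u₂ F + v₂ F}),
       (g * k, Submodule.span F {u₃ F + v₃ F}),
       (h * g * k, Submodule.span F {v₃ F - u₃ F})] := by
  have hgh := h𝒜.mul_mem _ _ _ _ he h1
  have hhk := h𝒜.mul_mem _ _ _ _ he hk
  have hgk := h𝒜.mul_mem _ _ _ _ h1 hk
  rw [e_mul_sub, mul_comm] at hgh
  rw [e_mul_sub] at hhk
  rw [sub_mul_sub] at hgk
  have hhgk := h𝒜.mul_mem _ _ _ _ he hgk
  rw [e_mul_add, ← mul_assoc] at hhgk
  apply h𝒜.eq_ofComponents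
  · simp only [List.forall_mem_cons, Submodule.span_singleton_le_iff_mem]
    exact ⟨h𝒜.one_mem, he, h1, hk, hgh, hhk, hgk, hhgk, by simp⟩
  · intro W hW
    simp only [List.forall_mem_cons, Submodule.span_singleton_le_iff_mem] at hW
    obtain ⟨w1, w2, w3, w4, w5, w6, w7, w8, -⟩ := hW
    exact eq_top_of_mem_of_two_ne_zero h2 w1 w2 (fun i => by fin_cases i <;> assumption)
      (fun i => by fin_cases i <;> assumption)

/-- The two traces are the sum and the difference of the diagonal entries. The sign of p anticipates
the comparison with vᵢ − uᵢ. -/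
theorem eq_mk_of_tr_eq_zero [CharZero F] {b : SplitOctonion F} (h1 : tr b = 0)
    (h2 : tr ((e₂ F - e₁ F) * b) = 0) : ∃ p q, b = mk 0 (-p) q 0 := by
  obtain ⟨x, p, q, y, rfl⟩ := exists_mk b
  simp only [e₁, e₂, mk_sub_mk, mk_mul_mk, tr_mk] at h1 h2
  simp only [sub_zero, zero_sub, zero_dotProduct, neg_mul, one_mul] at h2
  have hx : x = 0 := by linear_combination (h1 - h2) / 2
  have hy : y = 0 := by linear_combination (h1 + h2) / 2
  exact ⟨-p, q, by rw [hx, hy, neg_neg]⟩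

/-- Two anticommuting homogeneous involutions, both anticommuting with `e₂ - e₁`, can be moved to
`v₁ - u₁` and `v₂ - u₂`. -/
theorem exists_isAlgAut_pair [CharZero F] {b c : SplitOctonion F} (hb : b * b = 1) (hc : c * c = 1)
    (tb : tr b = 0) (tb' : tr ((e₂ F - e₁ F) * b) = 0) (tc : tr c = 0)
    (tc' : tr ((e₂ F - e₁ F) * c) = 0) (tbc : tr (b * c) = 0)
    (tbc' : tr ((e₂ F - e₁ F) * (b * c)) = 0) :
    ∃ f : SplitOctonion F ≃ₗ[F] SplitOctonion F, IsAlgAut f ∧ f (e₂ F - e₁ F) = e₂ F - e₁ F ∧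
      f (v₁ F - u₁ F) = b ∧ f (v₂ F - u₂ F) = c := by
  obtain ⟨p, q, rfl⟩ := eq_mk_of_tr_eq_zero tb tb'
  obtain ⟨r, s, rfl⟩ := eq_mk_of_tr_eq_zero tc tc'
  simp only [mk_mul_mk, one_eq, mk_inj] at hb hc
  have hpq : p ⬝ᵥ q = 1 := by simpa using hb.1
  have hrs : r ⬝ᵥ s = 1 := by simpa using hc.1
  simp only [e₁, e₂, mk_sub_mk, mk_mul_mk, tr_mk] at tbc tbc'
  simp only [mul_zero, neg_dotProduct, sub_neg_eq_add, zero_add, dotProduct_neg, sub_zero, zero_sub,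
    zero_dotProduct, neg_mul, one_mul] at tbc tbc'
  have hps : p ⬝ᵥ s = 0 := by linear_combination (tbc - tbc') / 2
  have hqr : r ⬝ᵥ q = 0 := by rw [dotProduct_comm]; linear_combination (tbc + tbc') / 2
  -- With third column q × s the matrix (p, r, q × s) has cofactor columns q and s in the first two
  -- places, and determinant p · q = 1. It therefore sends v₁ − u₁ to (−p, q) and v₂ − u₂ to (−r,
  -- s).
  have hv1 : crossProduct r (crossProduct q s) = q := by
    rw [cross_cross_eq, hrs, hqr, one_smul, zero_smul, sub_zero]
  have hv2 : crossProduct (crossProduct q s) p = s := by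
    rw [← cross_anticomm, cross_cross_eq, hpq, hps, one_smul, zero_smul, zero_sub, neg_neg]
  obtain ⟨f, hf, hf'⟩ := exists_isAlgAut_unimodular p r (crossProduct q s) (by rw [hv1, hpq])
  refine ⟨f, hf, ?_, ?_, ?_⟩
  · simp only [e₁, e₂, mk_sub_mk, hf']
    apply mk_congr <;> simp
  · simp only [u, v, mk_sub_mk, hf']
    apply mk_congr <;> simp [hv1]
  · simp only [u, v, mk_sub_mk, hf']
    apply mk_congr <;> simp [hv2]

theorem exists_involution_mem [IsAlgClosed F] [CharZero F] (h : IsGroupGrading 𝒜)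
    (hone : ∀ x ∈ 𝒜 1, tr x = 0 → x = 0) (hs : Subgroup.closure (gradingSupport 𝒜) = ⊤) {γ : Γ}
    (hγ : γ ≠ 1) : ∃ x ∈ 𝒜 γ, x * x = 1 := by
  obtain ⟨x, hx, hx0⟩ := exists_ne_zero_of_closure h hone hs γ
  obtain ⟨c, hc⟩ := exists_smul_mul_self_eq_one (tr_eq_zero h hγ hx) (nrm_ne_zero h hone hγ hx hx0)
  exact ⟨c • x, (𝒜 γ).smul_mem c hx, hc⟩

theorem exists_isType9 [IsAlgClosed F] [CharZero F] [Finite Γ] (h𝒜 : IsGroupGrading 𝒜)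
    (hone : ∀ x ∈ 𝒜 1, tr x = 0 → x = 0) (hs : Subgroup.closure (gradingSupport 𝒜) = ⊤) :
    ∃ f : SplitOctonion F ≃ₗ[F] SplitOctonion F, IsAlgAut f ∧ IsType9 (pullback f 𝒜) := by
  have hΓ : ∀ γ : Γ, γ * γ = 1 := fun γ => by
    obtain ⟨x, hx, hx0⟩ := exists_ne_zero_of_closure h𝒜 hone hs γ
    exact mul_self_eq_one_of_mem h𝒜 hone hx hx0
  have hcard := card_eq_eight h𝒜 hone hs
  obtain ⟨g, h, k, hn⟩ := exists_generators_of_card_eq_eight hcard hΓ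
  obtain ⟨φ, -⟩ := exists_cubeEquiv hΓ hcard hn
  have hn' := hn
  simp only [List.nodup_cons, List.mem_cons, List.not_mem_nil, not_or] at hn'
  obtain ⟨⟨h1, g1, k1, gh1, hk1, gk1, hgk1, -⟩, -⟩ := hn'
  have hord : ∀ γ : Γ, 1 ≠ γ → orderOf γ = 2 := fun γ hγ =>
    orderOf_eq_prime (by rw [pow_two, hΓ]) hγ.symm
  obtain ⟨a, ha, haa⟩ := exists_involution_mem h𝒜 hone hs (Ne.symm h1)
  obtain ⟨b, hb, hbb⟩ := exists_involution_mem h𝒜 hone hs (Ne.symm g1)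
  obtain ⟨c, hc, hcc⟩ := exists_involution_mem h𝒜 hone hs (Ne.symm k1)
  obtain ⟨f, hf, hfa⟩ := exists_isAlgAut_involution haa (tr_eq_zero h𝒜 (Ne.symm h1) ha)
  have hℬ := h𝒜.pullback hf
  have hf1 : f.symm 1 = 1 := by
    have := hf.symm (f 1) 1
    rwa [mul_one, f.symm_apply_apply, one_mul, eq_comm] at this
  have ha' : e₂ F - e₁ F ∈ pullback f 𝒜 h := by rwa [mem_pullback, hfa]
  have hb' : f.symm b ∈ pullback f 𝒜 g := by rwa [mem_pullback, f.apply_symm_apply]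
  have hc' : f.symm c ∈ pullback f 𝒜 k := by rwa [mem_pullback, f.apply_symm_apply]
  have hbc := hℬ.mul_mem _ _ _ _ hb' hc'
  -- All six elements involved have nontrivial degree by independence of g, h, k, so the required
  -- traces vanish.
  obtain ⟨ψ, hψ, hψa, hψb, hψc⟩ := exists_isAlgAut_pair (b := f.symm b) (c := f.symm c)
    (by rw [← hf.symm, hbb, hf1]) (by rw [← hf.symm, hcc, hf1])
    (tr_eq_zero hℬ (Ne.symm g1) hb')
    (tr_eq_zero hℬ (by rw [mul_comm]; exact Ne.symm gh1) (hℬ.mul_mem _ _ _ _ ha' hb'))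
    (tr_eq_zero hℬ (Ne.symm k1) hc')
    (tr_eq_zero hℬ (Ne.symm hk1) (hℬ.mul_mem _ _ _ _ ha' hc'))
    (tr_eq_zero hℬ (Ne.symm gk1) hbc)
    (tr_eq_zero hℬ (by rw [← mul_assoc]; exact Ne.symm hgk1) (hℬ.mul_mem _ _ _ _ ha' hbc))
  refine ⟨ψ.trans f, hψ.trans hf, ⟨φ.symm⟩, g, h, k, hord g g1, hord h h1, hord k k1, hn, ?_⟩
  apply eq_ofComponents_of_mem two_ne_zero (h𝒜.pullback (hψ.trans hf))
  · rwa [mem_pullback, LinearEquiv.trans_apply, hψa]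
  · rwa [mem_pullback, LinearEquiv.trans_apply, hψb]
  · rwa [mem_pullback, LinearEquiv.trans_apply, hψc]

end SplitOctonion

/-! ### Multiplication tables and the two model gradings -/

namespace SplitOctonion

variable {F : Type*} [Field F]

theorem u_mul_self (i : Fin 3) : u F i * u F i = 0 := by
  simp only [u, mk_mul_mk, zero_eq, cross_self]
  apply mk_congr <;> simp

theorem v_mul_self (i : Fin 3) : v F i * v F i = 0 := by
  simp only [v, mk_mul_mk, zero_eq, cross_self]
  apply mk_congr <;> simp

theorem u_mul_u' (i : Fin 3) : u F (i + 1) * u F i = -v F (i + 2) := by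
  rw [← u_mul_u]
  simp only [u, mk_mul_mk, neg_mk, cross_anticomm]
  rw [← cross_anticomm]
  apply mk_congr <;> simp

theorem v_mul_v' (i : Fin 3) : v F (i + 1) * v F i = -u F (i + 2) := by
  rw [← v_mul_v]
  simp only [v, mk_mul_mk, neg_mk]
  rw [← cross_anticomm]
  apply mk_congr <;> simp

theorem u_mul_v_of_ne {i j : Fin 3} (hij : i ≠ j) : u F i * v F j = 0 := by
  simp only [u, v, mk_mul_mk, zero_eq]
  apply mk_congr <;> simp [hij]

theorem v_mul_u_of_ne {i j : Fin 3} (hij : i ≠ j) : v F i * u F j = 0 := by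
  simp only [u, v, mk_mul_mk, zero_eq]
  apply mk_congr <;> simp [hij]

theorem e₁_mul_u (i : Fin 3) : e₁ F * u F i = u F i := by
  simp only [u, e₁, mk_mul_mk]; apply mk_congr <;> simp

theorem u_mul_e₁ (i : Fin 3) : u F i * e₁ F = 0 := by
  simp only [u, e₁, mk_mul_mk, zero_eq]; apply mk_congr <;> simp

theorem e₁_mul_v (i : Fin 3) : e₁ F * v F i = 0 := by
  simp only [v, e₁, mk_mul_mk, zero_eq]; apply mk_congr <;> simp

theorem v_mul_e₁ (i : Fin 3) : v F i * e₁ F = v F i := by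
  simp only [v, e₁, mk_mul_mk]; apply mk_congr <;> simp

theorem e₂_mul_u (i : Fin 3) : e₂ F * u F i = 0 := by
  simp only [u, e₂, mk_mul_mk, zero_eq]; apply mk_congr <;> simp

theorem u_mul_e₂ (i : Fin 3) : u F i * e₂ F = u F i := by
  simp only [u, e₂, mk_mul_mk]; apply mk_congr <;> simp

theorem e₂_mul_v (i : Fin 3) : e₂ F * v F i = v F i := by
  simp only [v, e₂, mk_mul_mk]; apply mk_congr <;> simp

theorem v_mul_e₂ (i : Fin 3) : v F i * e₂ F = 0 := by
  simp only [v, e₂, mk_mul_mk, zero_eq]; apply mk_congr <;> simp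

theorem e₁_mul_e₁ : e₁ F * e₁ F = e₁ F := by
  simp only [e₁, mk_mul_mk]; apply mk_congr <;> simp

theorem e₂_mul_e₂ : e₂ F * e₂ F = e₂ F := by
  simp only [e₂, mk_mul_mk]; apply mk_congr <;> simp

theorem e₁_mul_e₂ : e₁ F * e₂ F = 0 := by
  simp only [e₁, e₂, mk_mul_mk, zero_eq]; apply mk_congr <;> simp

theorem e₂_mul_e₁ : e₂ F * e₁ F = 0 := by
  simp only [e₁, e₂, mk_mul_mk, zero_eq]; apply mk_congr <;> simp

theorem fin_three_cases (i j : Fin 3) : j = i ∨ j = i + 1 ∨ i = j + 1 := by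
  revert i j; decide

theorem linearIndependent_of_span_eq_top {b : Fin 2 ⊕ Fin 3 ⊕ Fin 3 → SplitOctonion F}
    (hb : Submodule.span F (Set.range b) = ⊤) : LinearIndependent F b :=
  linearIndependent_of_top_le_span_of_card_eq_finrank hb.ge (by simp [finrank_eq])

variable (F) in
/-- The canonical basis. -/
def cartanBasis : Fin 2 ⊕ Fin 3 ⊕ Fin 3 → SplitOctonion F :=
  Sum.elim ![e₁ F, e₂ F] (Sum.elim (u F) (v F))

theorem span_cartanBasis : Submodule.span F (Set.range (cartanBasis F)) = ⊤ :=
  eq_top_of_basis_mem (Submodule.subset_span ⟨.inl 0, rfl⟩) (Submodule.subset_span ⟨.inl 1, rfl⟩)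
    (fun i => Submodule.subset_span ⟨.inr (.inl i), rfl⟩)
    (fun i => Submodule.subset_span ⟨.inr (.inr i), rfl⟩)

variable (F) in
/-- The basis of the `ℤ₂³`-grading. -/
def pauliBasis : Fin 2 ⊕ Fin 3 ⊕ Fin 3 → SplitOctonion F :=
  Sum.elim ![1, e₂ F - e₁ F] (Sum.elim (fun i => v F i - u F i) (fun i => u F i + v F i))

theorem span_pauliBasis (h2 : (2 : F) ≠ 0) :
    Submodule.span F (Set.range (pauliBasis F)) = ⊤ :=
  eq_top_of_mem_of_two_ne_zero h2 (Submodule.subset_span ⟨.inl 0, rfl⟩)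
    (Submodule.subset_span ⟨.inl 1, rfl⟩) (fun i => Submodule.subset_span ⟨.inr (.inl i), rfl⟩)
    (fun i => Submodule.subset_span ⟨.inr (.inr i), rfl⟩)

variable {Γ : Type*} [CommGroup Γ]

/-- The degrees of the canonical basis in a Cartan grading. -/
def cartanDegree (a : Fin 3 → Γ) : Fin 2 ⊕ Fin 3 ⊕ Fin 3 → Γ :=
  Sum.elim (fun _ => 1) (Sum.elim a fun i => (a i)⁻¹)

variable (F) in
/-- The grading for which `u i` has degree `a i` and the diagonal has degree `1`. -/
def cartanGrading (a : Fin 3 → Γ) : Γ → Submodule F (SplitOctonion F) :=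
  spanGrading F (cartanBasis F) (cartanDegree a)

theorem isCartan_cartanGrading (a : Fin 3 → Γ) : IsCartan (cartanGrading F a) a where
  e₁_mem := mem_spanGrading (cartanBasis F) (cartanDegree a) (.inl 0) rfl
  e₂_mem := mem_spanGrading (cartanBasis F) (cartanDegree a) (.inl 1) rfl
  u_mem i := mem_spanGrading (cartanBasis F) (cartanDegree a) (.inr (.inl i)) rfl
  v_mem i := mem_spanGrading (cartanBasis F) (cartanDegree a) (.inr (.inr i)) rfl

theorem mul_eq_inv_of_prod_eq_one {a : Fin 3 → Γ} (ha : a 0 * a 1 * a 2 = 1) (i : Fin 3) :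
    a i * a (i + 1) = (a (i + 2))⁻¹ := by
  rw [eq_inv_iff_mul_eq_one, ← ha]
  fin_cases i
  · rfl
  · change a 1 * a 2 * a 0 = _
    rw [mul_comm, mul_assoc]
  · change a 2 * a 0 * a 1 = _
    rw [mul_assoc, mul_comm]

variable [DecidableEq Γ]

/-- Product 1 is exactly what makes uᵢuᵢ₊₁ = vᵢ₊₂ and vᵢvᵢ₊₁ = uᵢ₊₂ homogeneous; the other products
of basis vectors impose no condition. -/
theorem isGroupGrading_cartanGrading {a : Fin 3 → Γ} (ha : a 0 * a 1 * a 2 = 1) :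
    IsGroupGrading (cartanGrading F a) := by
  refine isGroupGrading_spanGrading (linearIndependent_of_span_eq_top span_cartanBasis)
    span_cartanBasis ?_
  obtain ⟨h1, h2, hu, hv⟩ := isCartan_cartanGrading (F := F) a
  have hm := mul_eq_inv_of_prod_eq_one ha
  change ∀ i j, _ ∈ cartanGrading F a _
  have h0 : ∀ γ, (0 : SplitOctonion F) ∈ cartanGrading F a γ := fun γ => zero_mem _
  rintro (i | i | i) (j | j | j) <;> simp only [cartanBasis, cartanDegree, Sum.elim_inl,
    Sum.elim_inr, one_mul, mul_one]
  · fin_cases i <;> fin_cases j <;>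
      simp [e₁_mul_e₁, e₁_mul_e₂, e₂_mul_e₁, e₂_mul_e₂, h1, h2]
  · fin_cases i <;> simp [e₁_mul_u, e₂_mul_u, hu]
  · fin_cases i <;> simp [e₁_mul_v, e₂_mul_v, hv]
  · fin_cases j <;> simp [u_mul_e₁, u_mul_e₂, hu]
  · rcases fin_three_cases i j with rfl | rfl | rfl
    · rw [u_mul_self]; exact h0 _
    · rw [u_mul_u, hm]; exact hv _
    · rw [u_mul_u', mul_comm, hm]; exact neg_mem (hv _)
  · by_cases hij : i = j
    · subst hij; rw [u_mul_v, mul_inv_cancel]; exact neg_mem h1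
    · rw [u_mul_v_of_ne hij]; exact h0 _
  · fin_cases j <;> simp [v_mul_e₁, v_mul_e₂, hv]
  · by_cases hij : i = j
    · subst hij; rw [v_mul_u, inv_mul_cancel]; exact neg_mem h2
    · rw [v_mul_u_of_ne hij]; exact h0 _
  · rcases fin_three_cases i j with rfl | rfl | rfl
    · rw [v_mul_self]; exact h0 _
    · rw [v_mul_v, ← mul_inv, hm, inv_inv]; exact hu _
    · rw [v_mul_v', ← mul_inv, mul_comm, hm, inv_inv]; exact neg_mem (hu _)

theorem IsCartan.eq_cartanGrading {𝒜 : Γ → Submodule F (SplitOctonion F)} (h : IsGroupGrading 𝒜)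
    {a : Fin 3 → Γ} (hC : IsCartan 𝒜 a) : 𝒜 = cartanGrading F a := by
  refine h.eq_of_le (fun γ => Submodule.span_le.2 ?_) ?_
  · rintro _ ⟨i | i | i, rfl, rfl⟩
    · fin_cases i
      exacts [hC.e₁_mem, hC.e₂_mem]
    · exact hC.u_mem i
    · exact hC.v_mem i
  · obtain ⟨h1, h2, hu, hv⟩ := isCartan_cartanGrading (F := F) a
    exact eq_top_of_basis_mem (Submodule.mem_iSup_of_mem _ h1) (Submodule.mem_iSup_of_mem _ h2)
      (fun i => Submodule.mem_iSup_of_mem _ (hu i)) (fun i => Submodule.mem_iSup_of_mem _ (hv i))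

omit [DecidableEq Γ] in
theorem gradingSupport_cartanGrading (a : Fin 3 → Γ) :
    gradingSupport (cartanGrading F a) ⊆ Subgroup.closure (Set.range a) := by
  intro γ hγ
  have hmem : ∀ i, a i ∈ Subgroup.closure (Set.range a) := fun i =>
    Subgroup.subset_closure ⟨i, rfl⟩
  obtain ⟨_, ⟨i | i | i, rfl, rfl⟩⟩ : (cartanBasis F '' {i | cartanDegree a i = γ}).Nonempty := by
    by_contra hne
    rw [Set.not_nonempty_iff_eq_empty] at hne
    exact hγ (by rw [cartanGrading, spanGrading, hne, Submodule.span_empty])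
  · exact one_mem _
  · exact hmem i
  · exact inv_mem (hmem i)

/-- The degrees of `pauliBasis`. -/
def pauliDegree (h : Γ) (c : Fin 3 → Γ) : Fin 2 ⊕ Fin 3 ⊕ Fin 3 → Γ :=
  Sum.elim ![1, h] (Sum.elim c fun i => h * c i)

/-- Left multiplication by e₂ − e₁ exchanges vᵢ − uᵢ and uᵢ + vᵢ, so their degrees differ by h. The
product of the first two vᵢ − uᵢ is u₃ + v₃, which forces the condition on c. -/
theorem isGroupGrading_pauli (h2 : (2 : F) ≠ 0) (hΓ : ∀ γ : Γ, γ * γ = 1) {h : Γ}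
    {c : Fin 3 → Γ} (hc : c 0 * c 1 * c 2 = h) :
    IsGroupGrading (spanGrading F (pauliBasis F) (pauliDegree h c)) := by
  refine isGroupGrading_spanGrading (linearIndependent_of_span_eq_top (span_pauliBasis h2))
    (span_pauliBasis h2) ?_
  have mem := fun i => mem_spanGrading (F := F) (pauliBasis F) (pauliDegree h c) i rfl
  have m1 : (1 : SplitOctonion F) ∈ spanGrading F (pauliBasis F) (pauliDegree h c) 1 :=
    mem (.inl 0)
  have md : e₂ F - e₁ F ∈ spanGrading F (pauliBasis F) (pauliDegree h c) h := mem (.inl 1)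
  have mm : ∀ i, v F i - u F i ∈ spanGrading F (pauliBasis F) (pauliDegree h c) (c i) :=
    fun i => mem (.inr (.inl i))
  have ms : ∀ i, u F i + v F i ∈ spanGrading F (pauliBasis F) (pauliDegree h c) (h * c i) :=
    fun i => mem (.inr (.inr i))
  have hcc : ∀ i, c i * c (i + 1) = h * c (i + 2) := fun i => by
    have : c i * c (i + 1) * c (i + 2) = h := by
      rw [← hc]
      fin_cases i
      · rfl
      · change c 1 * c 2 * c 0 = _
        rw [mul_comm, mul_assoc]
      · change c 2 * c 0 * c 1 = _
        rw [mul_assoc, mul_comm]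
    rw [← this, mul_assoc, hΓ, mul_one]
  have hhh : ∀ x, h * (h * x) = x := fun x => by rw [← mul_assoc, hΓ, one_mul]
  have hdd : (e₂ F - e₁ F) * (e₂ F - e₁ F) = 1 := by
    simp [mul_sub, sub_mul, e₁_mul_e₁, e₁_mul_e₂, e₂_mul_e₁, e₂_mul_e₂, ← e₁_add_e₂, add_comm]
  generalize spanGrading F (pauliBasis F) (pauliDegree h c) = 𝒜 at *
  rintro (i | i | i) (j | j | j) <;> simp only [pauliBasis, pauliDegree, Sum.elim_inl,
    Sum.elim_inr]
  · fin_cases i <;> fin_cases j <;> simp [hdd, hΓ, m1, md]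
  · fin_cases i
    · simpa using mm j
    · simpa [e_mul_sub] using ms j
  · fin_cases i
    · simpa using ms j
    · simpa [e_mul_add, hhh] using mm j
  · fin_cases j
    · simpa using mm i
    · simpa [mul_sub, sub_mul, v_mul_e₁, v_mul_e₂, u_mul_e₁, u_mul_e₂, mul_comm, ← neg_add',
        add_comm] using neg_mem (ms i)
  · rcases fin_three_cases i j with rfl | rfl | rfl
    · rw [hΓ]
      simpa [mul_sub, sub_mul, u_mul_self, v_mul_self, u_mul_v, v_mul_u, e₁_add_e₂] using m1
    · rw [hcc]
      have := ms (i + 2)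
      simpa [mul_sub, sub_mul, u_mul_u, v_mul_v, u_mul_v_of_ne, v_mul_u_of_ne] using this
    · rw [mul_comm, hcc]
      have := neg_mem (ms (j + 2))
      convert this using 1
      simp [mul_sub, sub_mul, u_mul_u', v_mul_v', u_mul_v_of_ne, v_mul_u_of_ne]
      abel
  · rcases fin_three_cases i j with rfl | rfl | rfl
    · rw [mul_left_comm, hΓ, mul_one]
      have := neg_mem md
      simpa [mul_add, sub_mul, u_mul_self, v_mul_self, u_mul_v, v_mul_u, neg_add_eq_sub] using this
    · rw [mul_left_comm, hcc, hhh]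
      have := neg_mem (mm (i + 2))
      simpa [mul_add, sub_mul, u_mul_u, v_mul_v, u_mul_v_of_ne, v_mul_u_of_ne, neg_add_eq_sub] using this
    · rw [mul_left_comm, mul_comm (c _), hcc, hhh]
      have := mm (j + 2)
      convert this using 1
      simp [mul_add, sub_mul, u_mul_u', v_mul_v', u_mul_v_of_ne, v_mul_u_of_ne]
      abel
  · fin_cases j
    · simpa using ms i
    · have := neg_mem (mm i)
      simpa [mul_sub, add_mul, v_mul_e₁, v_mul_e₂, u_mul_e₁, u_mul_e₂, mul_comm, hhh] using this
  · rcases fin_three_cases i j with rfl | rfl | rfl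
    · rw [mul_assoc, hΓ, mul_one]
      simpa [mul_sub, add_mul, u_mul_self, v_mul_self, u_mul_v, v_mul_u, neg_add_eq_sub] using md
    · rw [mul_assoc, hcc, hhh]
      have := neg_mem (mm (i + 2))
      simpa [mul_sub, add_mul, u_mul_u, v_mul_v, u_mul_v_of_ne, v_mul_u_of_ne, neg_add_eq_sub] using this
    · rw [mul_assoc, mul_comm (c _), hcc, hhh]
      have := mm (j + 2)
      simpa [mul_sub, add_mul, u_mul_u', v_mul_v', u_mul_v_of_ne, v_mul_u_of_ne, neg_add_eq_sub] using this
  · rw [mul_mul_mul_comm, hΓ h, one_mul]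
    rcases fin_three_cases i j with rfl | rfl | rfl
    · rw [hΓ]
      have := neg_mem m1
      rw [← e₁_add_e₂] at this
      simpa [mul_add, add_mul, u_mul_self, v_mul_self, u_mul_v, v_mul_u, add_comm] using this
    · rw [hcc]
      have := ms (i + 2)
      simpa [mul_add, add_mul, u_mul_u, v_mul_v, u_mul_v_of_ne, v_mul_u_of_ne, add_comm] using this
    · rw [mul_comm (c _), hcc]
      have := neg_mem (ms (j + 2))
      simpa [mul_add, add_mul, u_mul_u', v_mul_v', u_mul_v_of_ne, v_mul_u_of_ne, add_comm] using this

end SplitOctonion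

/-! ### The nine families are gradings -/

namespace SplitOctonion

open Submodule

variable {F Γ : Type*} [Field F] [CommGroup Γ] {𝒜 : Γ → Submodule F (SplitOctonion F)}

theorem mem_component_of_eq {γ δ : Γ} {x : SplitOctonion F}
    (hx : x ∈ 𝒜 γ) (e : γ = δ) : x ∈ 𝒜 δ := e ▸ hx

theorem mul_self_eq_one_of_orderOf {g : Γ} (h : orderOf g = 2) : g * g = 1 := by
  rw [← pow_two, ← h, pow_orderOf_eq_one]

variable [DecidableEq Γ]

/-- As in the analogous results for Types 2–8, the vector lists the degrees of u₁, u₂, u₃. The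
result serves both to recognise a given grading and to prove that the family is one. -/
theorem IsCartan.eq_type1 (h𝒜 : IsGroupGrading 𝒜) {g h : Γ} (hh : h * h = 1)
    (hC : IsCartan 𝒜 ![g, g⁻¹ * h, h]) :
    𝒜 = ofComponents
      [(1, span F {e₁ F, e₂ F}),
       (g, span F {u₁ F}),
       (g⁻¹, span F {v₁ F}),
       (h, span F {u₃ F, v₃ F}),
       (g * h, span F {v₂ F}),
       (g⁻¹ * h, span F {u₂ F})] := by
  apply h𝒜.eq_ofComponents
  · simp only [List.forall_mem_cons, span_le, Set.insert_subset_iff, Set.singleton_subset_iff,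
      SetLike.mem_coe]
    exact ⟨⟨hC.e₁_mem, hC.e₂_mem⟩, hC.u_mem 0, hC.v_mem 0, ⟨hC.u_mem 2, mem_component_of_eq (hC.v_mem 2) (inv_eq_of_mul_eq_one_left hh)⟩, mem_component_of_eq (hC.v_mem 1) (by change (g⁻¹ * h)⁻¹ = _; rw [mul_inv, inv_inv, inv_eq_of_mul_eq_one_left hh]), hC.u_mem 1, by simp⟩
  · intro W hW
    simp only [List.forall_mem_cons, span_le, Set.insert_subset_iff, Set.singleton_subset_iff,
      SetLike.mem_coe] at hW
    obtain ⟨⟨he₁, he₂⟩, hu₁, hv₁, ⟨hu₃, hv₃⟩, hv₂, hu₂, -⟩ := hW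
    exact eq_top_of_basis_mem he₁ he₂ (fun i => by fin_cases i <;> assumption)
      (fun i => by fin_cases i <;> assumption)

theorem IsCartan.eq_type2 (h𝒜 : IsGroupGrading 𝒜) {g h : Γ} 
    (hC : IsCartan 𝒜 ![g, h, g⁻¹ * h⁻¹]) :
    𝒜 = ofComponents
      [(1, span F {e₁ F, e₂ F}),
       (g, span F {u₁ F}),
       (h, span F {u₂ F}),
       (g * h, span F {v₃ F}),
       (g⁻¹, span F {v₁ F}),
       (h⁻¹, span F {v₂ F}),
       (g⁻¹ * h⁻¹, span F {u₃ F})] := by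
  apply h𝒜.eq_ofComponents
  · simp only [List.forall_mem_cons, span_le, Set.insert_subset_iff, Set.singleton_subset_iff,
      SetLike.mem_coe]
    exact ⟨⟨hC.e₁_mem, hC.e₂_mem⟩, hC.u_mem 0, hC.u_mem 1, mem_component_of_eq (hC.v_mem 2) (by change (g⁻¹ * h⁻¹)⁻¹ = _; rw [mul_inv, inv_inv, inv_inv]), hC.v_mem 0, hC.v_mem 1, hC.u_mem 2, by simp⟩
  · intro W hW
    simp only [List.forall_mem_cons, span_le, Set.insert_subset_iff, Set.singleton_subset_iff,
      SetLike.mem_coe] at hW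
    obtain ⟨⟨he₁, he₂⟩, hu₁, hu₂, hv₃, hv₁, hv₂, hu₃, -⟩ := hW
    exact eq_top_of_basis_mem he₁ he₂ (fun i => by fin_cases i <;> assumption)
      (fun i => by fin_cases i <;> assumption)

theorem IsCartan.eq_type3 (h𝒜 : IsGroupGrading 𝒜) {h : Γ} 
    (hC : IsCartan 𝒜 ![(h ^ 2)⁻¹, h, h]) :
    𝒜 = ofComponents
      [(1, span F {e₁ F, e₂ F}),
       (h, span F {u₂ F, u₃ F}),
       (h⁻¹, span F {v₂ F, v₃ F}),
       ((h ^ 2)⁻¹, span F {u₁ F}),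
       (h ^ 2, span F {v₁ F})] := by
  apply h𝒜.eq_ofComponents
  · simp only [List.forall_mem_cons, span_le, Set.insert_subset_iff, Set.singleton_subset_iff,
      SetLike.mem_coe]
    exact ⟨⟨hC.e₁_mem, hC.e₂_mem⟩, ⟨hC.u_mem 1, hC.u_mem 2⟩, ⟨hC.v_mem 1, hC.v_mem 2⟩, hC.u_mem 0, mem_component_of_eq (hC.v_mem 0) (inv_inv _), by simp⟩
  · intro W hW
    simp only [List.forall_mem_cons, span_le, Set.insert_subset_iff, Set.singleton_subset_iff,
      SetLike.mem_coe] at hW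
    obtain ⟨⟨he₁, he₂⟩, ⟨hu₂, hu₃⟩, ⟨hv₂, hv₃⟩, hu₁, hv₁, -⟩ := hW
    exact eq_top_of_basis_mem he₁ he₂ (fun i => by fin_cases i <;> assumption)
      (fun i => by fin_cases i <;> assumption)

theorem IsCartan.eq_type4 (h𝒜 : IsGroupGrading 𝒜) {g : Γ} 
    (hC : IsCartan 𝒜 ![1, g, g⁻¹]) :
    𝒜 = ofComponents
      [(1, span F {e₁ F, e₂ F, u₁ F, v₁ F}),
       (g, span F {u₂ F, v₃ F}),
       (g⁻¹, span F {u₃ F, v₂ F})] := by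
  apply h𝒜.eq_ofComponents
  · simp only [List.forall_mem_cons, span_le, Set.insert_subset_iff, Set.singleton_subset_iff,
      SetLike.mem_coe]
    exact ⟨⟨hC.e₁_mem, hC.e₂_mem, hC.u_mem 0, mem_component_of_eq (hC.v_mem 0) (inv_one)⟩, ⟨hC.u_mem 1, mem_component_of_eq (hC.v_mem 2) (inv_inv _)⟩, ⟨hC.u_mem 2, hC.v_mem 1⟩, by simp⟩
  · intro W hW
    simp only [List.forall_mem_cons, span_le, Set.insert_subset_iff, Set.singleton_subset_iff,
      SetLike.mem_coe] at hW
    obtain ⟨⟨he₁, he₂, hu₁, hv₁⟩, ⟨hu₂, hv₃⟩, ⟨hu₃, hv₂⟩, -⟩ := hW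
    exact eq_top_of_basis_mem he₁ he₂ (fun i => by fin_cases i <;> assumption)
      (fun i => by fin_cases i <;> assumption)

theorem IsCartan.eq_type5 (h𝒜 : IsGroupGrading 𝒜) {g : Γ} 
    (hC : IsCartan 𝒜 ![g, g, g]) :
    𝒜 = ofComponents
      [(1, span F {e₁ F, e₂ F}),
       (g, span F {u₁ F, u₂ F, u₃ F}),
       (g⁻¹, span F {v₁ F, v₂ F, v₃ F})] := by
  apply h𝒜.eq_ofComponents
  · simp only [List.forall_mem_cons, span_le, Set.insert_subset_iff, Set.singleton_subset_iff,
      SetLike.mem_coe]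
    exact ⟨⟨hC.e₁_mem, hC.e₂_mem⟩, ⟨hC.u_mem 0, hC.u_mem 1, hC.u_mem 2⟩, ⟨hC.v_mem 0, hC.v_mem 1, hC.v_mem 2⟩, by simp⟩
  · intro W hW
    simp only [List.forall_mem_cons, span_le, Set.insert_subset_iff, Set.singleton_subset_iff,
      SetLike.mem_coe] at hW
    obtain ⟨⟨he₁, he₂⟩, ⟨hu₁, hu₂, hu₃⟩, ⟨hv₁, hv₂, hv₃⟩, -⟩ := hW
    exact eq_top_of_basis_mem he₁ he₂ (fun i => by fin_cases i <;> assumption)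
      (fun i => by fin_cases i <;> assumption)

theorem IsCartan.eq_type6 (h𝒜 : IsGroupGrading 𝒜) {g : Γ} (hg : g ^ 2 * g ^ 2 = 1)
    (hC : IsCartan 𝒜 ![g, g, g ^ 2]) :
    𝒜 = ofComponents
      [(1, span F {e₁ F, e₂ F}),
       (g, span F {u₁ F, u₂ F}),
       (g⁻¹, span F {v₁ F, v₂ F}),
       (g ^ 2, span F {u₃ F, v₃ F})] := by
  apply h𝒜.eq_ofComponents
  · simp only [List.forall_mem_cons, span_le, Set.insert_subset_iff, Set.singleton_subset_iff,
      SetLike.mem_coe]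
    exact ⟨⟨hC.e₁_mem, hC.e₂_mem⟩, ⟨hC.u_mem 0, hC.u_mem 1⟩, ⟨hC.v_mem 0, hC.v_mem 1⟩, ⟨hC.u_mem 2, mem_component_of_eq (hC.v_mem 2) (inv_eq_of_mul_eq_one_left hg)⟩, by simp⟩
  · intro W hW
    simp only [List.forall_mem_cons, span_le, Set.insert_subset_iff, Set.singleton_subset_iff,
      SetLike.mem_coe] at hW
    obtain ⟨⟨he₁, he₂⟩, ⟨hu₁, hu₂⟩, ⟨hv₁, hv₂⟩, ⟨hu₃, hv₃⟩, -⟩ := hW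
    exact eq_top_of_basis_mem he₁ he₂ (fun i => by fin_cases i <;> assumption)
      (fun i => by fin_cases i <;> assumption)

theorem IsCartan.eq_type7 (h𝒜 : IsGroupGrading 𝒜) {g : Γ} (hg : g * g = 1)
    (hC : IsCartan 𝒜 ![1, g, g]) :
    𝒜 = ofComponents
      [(1, span F {e₁ F, e₂ F, u₁ F, v₁ F}),
       (g, span F {u₂ F, v₂ F, u₃ F, v₃ F})] := by
  apply h𝒜.eq_ofComponents
  · simp only [List.forall_mem_cons, span_le, Set.insert_subset_iff, Set.singleton_subset_iff,
      SetLike.mem_coe]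
    exact ⟨⟨hC.e₁_mem, hC.e₂_mem, hC.u_mem 0, mem_component_of_eq (hC.v_mem 0) (inv_one)⟩, ⟨hC.u_mem 1, mem_component_of_eq (hC.v_mem 1) (inv_eq_of_mul_eq_one_left hg), hC.u_mem 2, mem_component_of_eq (hC.v_mem 2) (inv_eq_of_mul_eq_one_left hg)⟩, by simp⟩
  · intro W hW
    simp only [List.forall_mem_cons, span_le, Set.insert_subset_iff, Set.singleton_subset_iff,
      SetLike.mem_coe] at hW
    obtain ⟨⟨he₁, he₂, hu₁, hv₁⟩, ⟨hu₂, hv₂, hu₃, hv₃⟩, -⟩ := hW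
    exact eq_top_of_basis_mem he₁ he₂ (fun i => by fin_cases i <;> assumption)
      (fun i => by fin_cases i <;> assumption)

theorem IsCartan.eq_type8 (h𝒜 : IsGroupGrading 𝒜) {g h : Γ} (hg : g * g = 1) (hh : h * h = 1)
    (hC : IsCartan 𝒜 ![g, h, g * h]) :
    𝒜 = ofComponents
      [(1, span F {e₁ F, e₂ F}),
       (g, span F {u₁ F, v₁ F}),
       (h, span F {u₂ F, v₂ F}),
       (g * h, span F {u₃ F, v₃ F})] := by
  apply h𝒜.eq_ofComponents
  · simp only [List.forall_mem_cons, span_le, Set.insert_subset_iff, Set.singleton_subset_iff,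
      SetLike.mem_coe]
    exact ⟨⟨hC.e₁_mem, hC.e₂_mem⟩, ⟨hC.u_mem 0, mem_component_of_eq (hC.v_mem 0) (inv_eq_of_mul_eq_one_left hg)⟩, ⟨hC.u_mem 1, mem_component_of_eq (hC.v_mem 1) (inv_eq_of_mul_eq_one_left hh)⟩, ⟨hC.u_mem 2, mem_component_of_eq (hC.v_mem 2) (by change (g * h)⁻¹ = _; rw [mul_inv, inv_eq_of_mul_eq_one_left hg, inv_eq_of_mul_eq_one_left hh])⟩, by simp⟩
  · intro W hW
    simp only [List.forall_mem_cons, span_le, Set.insert_subset_iff, Set.singleton_subset_iff,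
      SetLike.mem_coe] at hW
    obtain ⟨⟨he₁, he₂⟩, ⟨hu₁, hv₁⟩, ⟨hu₂, hv₂⟩, ⟨hu₃, hv₃⟩, -⟩ := hW
    exact eq_top_of_basis_mem he₁ he₂ (fun i => by fin_cases i <;> assumption)
      (fun i => by fin_cases i <;> assumption)

/-- Applying the recognition result to the model grading with degrees `a` identifies ℬ with
something already known to be a grading. -/
theorem isGroupGrading_of_eq {ℬ : Γ → Submodule F (SplitOctonion F)} (a : Fin 3 → Γ)
    (ha : a 0 * a 1 * a 2 = 1)
    (h : ∀ 𝒜 : Γ → Submodule F (SplitOctonion F), IsGroupGrading 𝒜 → IsCartan 𝒜 a → 𝒜 = ℬ) :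
    IsGroupGrading ℬ := by
  rw [← h _ (isGroupGrading_cartanGrading ha) (isCartan_cartanGrading a)]
  exact isGroupGrading_cartanGrading ha

theorem IsStandardType.isGroupGrading (h2 : (2 : F) ≠ 0) (h : IsStandardType 𝒜) :
    IsGroupGrading 𝒜 := by
  rcases h with h | h | h | h | h | h | h | h | h
  · obtain ⟨g, h, -, hh, -, rfl⟩ := h
    have hh' := mul_self_eq_one_of_orderOf hh
    exact isGroupGrading_of_eq ![g, g⁻¹ * h, h] (by simp [hh'])
      fun _ h hC => hC.eq_type1 h hh'
  · obtain ⟨g, h, -, -, -, rfl⟩ := h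
    exact isGroupGrading_of_eq ![g, h, g⁻¹ * h⁻¹] (by change g * h * (g⁻¹ * h⁻¹) = 1; rw [← mul_inv, mul_inv_cancel])
      fun _ h hC => hC.eq_type2 h
  · obtain ⟨h, -, rfl⟩ := h
    exact isGroupGrading_of_eq ![(h ^ 2)⁻¹, h, h] (by simp [pow_two])
      fun _ h hC => hC.eq_type3 h
  · obtain ⟨g, -, rfl⟩ := h
    exact isGroupGrading_of_eq ![1, g, g⁻¹] (by simp) fun _ h hC => hC.eq_type4 h
  · obtain ⟨-, g, hg, rfl⟩ := h
    exact isGroupGrading_of_eq ![g, g, g]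
      (by simp [← pow_two, ← pow_succ, ← hg, pow_orderOf_eq_one]) fun _ h hC => hC.eq_type5 h
  · obtain ⟨-, g, hg, rfl⟩ := h
    have hg' : g ^ 2 * g ^ 2 = 1 := by rw [← pow_add, ← pow_orderOf_eq_one g, hg]
    exact isGroupGrading_of_eq ![g, g, g ^ 2] (by change g * g * g ^ 2 = 1; rwa [← pow_two])
      fun _ h hC => hC.eq_type6 h hg'
  · obtain ⟨-, g, hg, rfl⟩ := h
    have hg' := mul_self_eq_one_of_orderOf hg
    exact isGroupGrading_of_eq ![1, g, g] (by simp [hg']) fun _ h hC => hC.eq_type7 h hg'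
  · obtain ⟨-, g, h, hg, hh, -, rfl⟩ := h
    have hg' := mul_self_eq_one_of_orderOf hg
    have hh' := mul_self_eq_one_of_orderOf hh
    exact isGroupGrading_of_eq ![g, h, g * h]
      (by simp [mul_mul_mul_comm, hg', hh']) fun _ h hC => hC.eq_type8 h hg' hh'
  · obtain ⟨⟨φ⟩, g, h, k, hg, hh, hk, -, rfl⟩ := h
    have hΓ : ∀ γ : Γ, γ * γ = 1 := fun γ => by
      apply φ.injective
      rw [map_mul, map_one]
      generalize φ γ = x
      revert x
      decide
    -- The vector v₃ − u₃ has degree hgk, and g · k · hgk = h in exponent two.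
    have hp := isGroupGrading_pauli (F := F) h2 hΓ (h := h) (c := ![g, k, h * g * k])
      (by
        change g * k * (h * g * k) = h
        rw [show g * k * (h * g * k) = (g * g) * (k * k) * h by ac_rfl, hΓ, hΓ, one_mul, one_mul])
    have mem := fun i => mem_spanGrading (F := F) (pauliBasis F)
      (pauliDegree h ![g, k, h * g * k]) i rfl
    rwa [eq_ofComponents_of_mem h2 hp (mem (.inl 1)) (mem (.inr (.inl 0))) (mem (.inr (.inl 1)))]
      at hp

end SplitOctonion

/-! ### Case analysis on the degrees -/

namespace SplitOctonion

section GroupTheory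

variable {G : Type*} [Group G]

theorem two_lt_orderOf [Finite G] {g : G} (h1 : g ≠ 1) (h2 : g * g ≠ 1) : 2 < orderOf g := by
  by_contra! hle
  have h0 := orderOf_pos g
  have hp := pow_orderOf_eq_one g
  interval_cases orderOf g
  · rw [pow_one] at hp; exact h1 hp
  · rw [pow_two] at hp; exact h2 hp

theorem orderOf_eq_two {g : G} (h1 : g ≠ 1) (h2 : g * g = 1) : orderOf g = 2 :=
  orderOf_eq_prime (by rw [pow_two, h2]) h1

theorem nonempty_mulEquiv_zmod {g : G} {n : ℕ} [NeZero n]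
    (hg : orderOf g = n) (hs : Subgroup.closure {g} = ⊤) :
    Nonempty (G ≃* Multiplicative (ZMod n)) := by
  have hc : ∀ x : G, x ∈ Subgroup.zpowers g := fun x => by
    rw [Subgroup.zpowers_eq_closure, hs]; trivial
  have : IsCyclic G := ⟨g, hc⟩
  refine ⟨mulEquivOfCyclicCardEq ?_⟩
  rw [← orderOf_eq_card_of_forall_mem_zpowers hc, hg, Nat.card_congr Multiplicative.toAdd]
  simp

theorem closure_eq_top_of_subset {s : Set G} {t : Set G} (hs : Subgroup.closure s = ⊤)
    (h : ∀ x ∈ s, x ∈ Subgroup.closure t) : Subgroup.closure t = ⊤ := by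
  rw [eq_top_iff, ← hs, Subgroup.closure_le]
  exact h

end GroupTheory

variable {F Γ : Type*} [Field F] [CommGroup Γ] [Finite Γ] [DecidableEq Γ]
  {𝒜 : Γ → Submodule F (SplitOctonion F)} {a : Fin 3 → Γ}

/-- The degrees are 1, g, g⁻¹ with g generating the nontrivial group Γ: Type 7 if g² = 1, Type 4
otherwise. -/
theorem IsCartan.isStandardType_of_eq_one (hC : IsCartan 𝒜 a) (h𝒜 : IsGroupGrading 𝒜)
    [Nontrivial Γ] (ha : a 0 * a 1 * a 2 = 1) (hs : Subgroup.closure (Set.range a) = ⊤)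
    (h0 : a 0 = 1) : IsStandardType 𝒜 := by
  rw [h0, one_mul] at ha
  have h2 : a 2 = (a 1)⁻¹ := eq_inv_of_mul_eq_one_right ha
  have hs' : Subgroup.closure {a 1} = ⊤ := closure_eq_top_of_subset hs (by
    have hm : a 1 ∈ Subgroup.closure {a 1} := Subgroup.subset_closure rfl
    rintro _ ⟨i, rfl⟩
    fin_cases i
    · change a 0 ∈ _
      rw [h0]; exact one_mem _
    · exact hm
    · change a 2 ∈ _
      rw [h2]; exact inv_mem hm)
  have h1 : a 1 ≠ 1 := fun h1 => by
    rw [h1, Subgroup.closure_singleton_one] at hs'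
    exact bot_ne_top hs'
  have e : a = ![1, a 1, (a 1)⁻¹] := funext_three h0 rfl h2
  generalize a 1 = g at *
  subst e
  by_cases hg : g * g = 1
  · have hg2 := orderOf_eq_two h1 hg
    rw [inv_eq_of_mul_eq_one_left hg] at hC
    exact .inr <| .inr <| .inr <| .inr <| .inr <| .inr <| .inl
      ⟨nonempty_mulEquiv_zmod hg2 hs', g, hg2, hC.eq_type7 h𝒜 hg⟩
  · exact .inr <| .inr <| .inr <| .inl ⟨g, two_lt_orderOf h1 hg, hC.eq_type4 h𝒜⟩

/-- The degrees are g, g⁻¹h, h with h an involution. If g² = 1 this is Type 8; if g = g⁻¹h then h =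
g² and g has order 4, Type 6; otherwise Type 1. -/
theorem IsCartan.isStandardType_of_involution (hC : IsCartan 𝒜 a) (h𝒜 : IsGroupGrading 𝒜)
    (ha : a 0 * a 1 * a 2 = 1) (hs : Subgroup.closure (Set.range a) = ⊤)
    (h0 : a 0 ≠ 1) (h1 : a 1 ≠ 1) (h2 : a 2 ≠ 1) (h22 : a 2 * a 2 = 1) : IsStandardType 𝒜 := by
  have hinv := inv_eq_of_mul_eq_one_left h22
  have e1 : a 1 = (a 0)⁻¹ * a 2 := by
    rw [← hinv, eq_inv_mul_iff_mul_eq, eq_inv_iff_mul_eq_one, ha]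
  by_cases h00 : a 0 * a 0 = 1
  · have e2 : a 2 = a 0 * a 1 := by rw [e1, mul_inv_cancel_left]
    have h11 : a 1 * a 1 = 1 := by
      rw [e1, mul_mul_mul_comm, h22, mul_one, ← mul_inv, h00, inv_one]
    have h01 : a 0 ≠ a 1 := fun h => h2 (by rw [e2, ← h, h00])
    have hs' : Subgroup.closure {a 0, a 1} = ⊤ := closure_eq_top_of_subset hs (by
      have hm0 : a 0 ∈ Subgroup.closure {a 0, a 1} := Subgroup.subset_closure (by simp)
      have hm1 : a 1 ∈ Subgroup.closure {a 0, a 1} := Subgroup.subset_closure (by simp)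
      rintro _ ⟨i, rfl⟩
      fin_cases i
      · exact hm0
      · exact hm1
      · change a 2 ∈ _
        rw [e2]; exact mul_mem hm0 hm1)
    have hΓ : ∀ γ : Γ, γ * γ = 1 := fun γ => by
      have hγ : γ ∈ Subgroup.closure {a 0, a 1} := by rw [hs']; trivial
      induction hγ using Subgroup.closure_induction with
      | mem x hx => rcases hx with rfl | rfl <;> assumption
      | one => exact mul_one 1
      | mul x y _ _ hx hy => rw [mul_mul_mul_comm, hx, hy, mul_one]
      | inv x _ hx => rw [← mul_inv, hx, inv_one]
    obtain ⟨φ, -⟩ := exists_squareEquiv hΓ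
      ⟨squareHom_injective hΓ h0 h1 h01, squareHom_surjective hΓ hs'⟩
    have e : a = ![a 0, a 1, a 0 * a 1] := funext_three rfl rfl e2
    rw [e] at hC
    exact .inr <| .inr <| .inr <| .inr <| .inr <| .inr <| .inr <| .inl
      ⟨⟨φ.symm⟩, a 0, a 1, orderOf_eq_two h0 h00, orderOf_eq_two h1 h11, h01,
        hC.eq_type8 h𝒜 h00 h11⟩
  · by_cases h01 : a 0 = a 1
    · have e2 : a 2 = a 0 ^ 2 := by
        rw [← h01, eq_inv_mul_iff_mul_eq] at e1
        rw [pow_two, e1]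
      have hs' : Subgroup.closure {a 0} = ⊤ := closure_eq_top_of_subset hs (by
        have hm : a 0 ∈ Subgroup.closure {a 0} := Subgroup.subset_closure rfl
        rintro _ ⟨i, rfl⟩
        fin_cases i
        · exact hm
        · change a 1 ∈ _
          rw [← h01]; exact hm
        · change a 2 ∈ _
          rw [e2]; exact pow_mem hm 2)
      have e : a = ![a 0, a 0, a 0 ^ 2] := funext_three rfl h01.symm e2
      rw [e2] at h22
      have ho : orderOf (a 0) = 4 := orderOf_eq_prime_pow (p := 2) (n := 1)
        (by rw [pow_one, pow_two]; exact h00) (by rw [← h22, ← pow_add]; norm_num)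
      rw [e] at hC
      exact .inr <| .inr <| .inr <| .inr <| .inr <| .inl
        ⟨nonempty_mulEquiv_zmod ho hs', a 0, ho, hC.eq_type6 h𝒜 h22⟩
    · have e : a = ![a 0, (a 0)⁻¹ * a 2, a 2] := funext_three rfl e1 rfl
      rw [e] at hC
      refine .inl ⟨a 0, a 2, two_lt_orderOf h0 h00, orderOf_eq_two h2 h22, ?_,
        hC.eq_type1 h𝒜 h22⟩
      -- Distinctness of the six degrees is now a word problem in a commutative group, with `g'`
      -- known only through g g' = 1.
      have hgi := mul_inv_cancel (a 0)
      rw [e1] at h01 h1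
      generalize (a 0)⁻¹ = g' at *
      generalize a 0 = g at *
      generalize a 2 = h at *
      clear e hC hs ha e1 hinv
      simp only [List.nodup_cons, List.mem_cons, List.not_mem_nil, not_or, or_false,
        not_false_eq_true, List.nodup_nil, and_true]
      repeat' apply And.intro
      all_goals first | trivial | (intro e; grind)

/-- The degrees are h⁻², h, h. If all agree, h has order 3 and the type is 5. Otherwise orders 2, 3
and 4 of h would give h² = 1, h⁻² = h and (h⁻²)² = 1 respectively, so the order exceeds 4 and the
type is 3. -/
theorem IsCartan.isStandardType_of_eq (hC : IsCartan 𝒜 a) (h𝒜 : IsGroupGrading 𝒜)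
    (ha : a 0 * a 1 * a 2 = 1) (hs : Subgroup.closure (Set.range a) = ⊤)
    (h0 : a 0 * a 0 ≠ 1) (h1 : a 1 * a 1 ≠ 1) (h12 : a 1 = a 2) : IsStandardType 𝒜 := by
  have e0 : a 0 = (a 1 ^ 2)⁻¹ := by
    rw [eq_inv_iff_mul_eq_one, pow_two, ← mul_assoc, ← ha, ← h12]
  have h1' : a 1 ≠ 1 := fun h => h1 (by rw [h, mul_one])
  by_cases h01 : a 0 = a 1
  · have e : a = ![a 1, a 1, a 1] := funext_three h01 rfl h12.symm
    have ho : orderOf (a 1) = 3 := orderOf_eq_prime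
      (by rw [← ha, h01, ← h12, pow_succ, pow_two]) h1'
    have hs' : Subgroup.closure {a 1} = ⊤ := closure_eq_top_of_subset hs (by
      have hm : a 1 ∈ Subgroup.closure {a 1} := Subgroup.subset_closure rfl
      rintro _ ⟨i, rfl⟩
      fin_cases i
      · change a 0 ∈ _
        rw [h01]; exact hm
      · exact hm
      · change a 2 ∈ _
        rw [← h12]; exact hm)
    rw [e] at hC
    exact .inr <| .inr <| .inr <| .inr <| .inl
      ⟨nonempty_mulEquiv_zmod ho hs', a 1, ho, hC.eq_type5 h𝒜⟩
  · have e : a = ![(a 1 ^ 2)⁻¹, a 1, a 1] := funext_three e0 rfl h12.symm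
    have ho : 4 < orderOf (a 1) := by
      by_contra! hle
      have hpos := orderOf_pos (a 1)
      have hp := pow_orderOf_eq_one (a 1)
      interval_cases orderOf (a 1)
      · exact h1' (by rwa [pow_one] at hp)
      · exact h1 (by rwa [pow_two] at hp)
      · exact h01 (by rw [e0, inv_eq_iff_mul_eq_one, ← pow_succ, hp])
      · exact h0 (by rw [e0, ← mul_inv, ← pow_add, hp, inv_one])
    rw [e] at hC
    exact .inr <| .inr <| .inl ⟨a 1, ho, hC.eq_type3 h𝒜⟩

/-- A relation between one degree and the inverse of another would make the third degree 1, so the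
three degrees and their inverses stay distinct. -/
theorem IsCartan.isStandardType_of_ne (hC : IsCartan 𝒜 a) (h𝒜 : IsGroupGrading 𝒜)
    (ha : a 0 * a 1 * a 2 = 1) (h0 : a 0 * a 0 ≠ 1) (h1 : a 1 * a 1 ≠ 1) (h2 : a 2 * a 2 ≠ 1)
    (h01 : a 0 ≠ a 1) (h02 : a 0 ≠ a 2) (h12 : a 1 ≠ a 2) : IsStandardType 𝒜 := by
  have e2 : a 2 = (a 0)⁻¹ * (a 1)⁻¹ := by
    rw [← mul_inv]; exact eq_inv_of_mul_eq_one_right ha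
  have h0' : a 0 ≠ 1 := fun h => h0 (by rw [h, mul_one])
  have h1' : a 1 ≠ 1 := fun h => h1 (by rw [h, mul_one])
  have h2' : a 2 ≠ 1 := fun h => h2 (by rw [h, mul_one])
  have e : a = ![a 0, a 1, (a 0)⁻¹ * (a 1)⁻¹] := funext_three rfl rfl e2
  rw [e] at hC
  refine .inr <| .inl ⟨a 0, a 1, two_lt_orderOf h0' h0, two_lt_orderOf h1' h1, ?_,
    hC.eq_type2 h𝒜⟩
  have hgi := mul_inv_cancel (a 0)
  have hhi := mul_inv_cancel (a 1)
  rw [e2] at h2' h2 h02 h12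
  clear e e2 hC ha
  generalize (a 0)⁻¹ = g' at *
  generalize (a 1)⁻¹ = h' at *
  generalize a 0 = g at *
  generalize a 1 = h at *
  simp only [List.nodup_cons, List.mem_cons, List.not_mem_nil, not_or, or_false,
    not_false_eq_true, List.nodup_nil, and_true]
  repeat' apply And.intro
  all_goals first | trivial | (intro e; grind)

/-- A grading with homogeneous canonical basis is of a standard type when the degrees are suitably
ordered. -/
theorem exists_perm_isStandardType [Nontrivial Γ]
    (ha : a 0 * a 1 * a 2 = 1) (hs : Subgroup.closure (Set.range a) = ⊤) :
    ∃ π : Equiv.Perm (Fin 3), ∀ 𝒜 : Γ → Submodule F (SplitOctonion F), IsGroupGrading 𝒜 →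
      IsCartan 𝒜 (a ∘ π) → IsStandardType 𝒜 := by
  have hp : ∀ π : Equiv.Perm (Fin 3), (a ∘ π) 0 * (a ∘ π) 1 * (a ∘ π) 2 = 1 := fun π => by
    rw [← Fin.prod_univ_three, ← ha, ← Fin.prod_univ_three]
    exact Equiv.prod_comp π a
  have hr : ∀ π : Equiv.Perm (Fin 3), Subgroup.closure (Set.range (a ∘ π)) = ⊤ := fun π => by
    rw [π.surjective.range_comp, hs]
  -- The transpositions put a trivial degree in position 0, an involution in position 2, or an equal
  -- pair in positions 1 and 2.
  by_cases h1 : ∃ i, a i = 1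
  · obtain ⟨i, hi⟩ := h1
    exact ⟨Equiv.swap 0 i, fun 𝒜 h𝒜 hC => hC.isStandardType_of_eq_one h𝒜 (hp _) (hr _)
      (by simpa using hi)⟩
  push Not at h1
  by_cases h2 : ∃ i, a i * a i = 1
  · obtain ⟨i, hi⟩ := h2
    exact ⟨Equiv.swap 2 i, fun 𝒜 h𝒜 hC => hC.isStandardType_of_involution h𝒜 (hp _) (hr _)
      (h1 _) (h1 _) (h1 _) (by simpa using hi)⟩
  push Not at h2
  by_cases h12 : a 1 = a 2
  · exact ⟨1, fun 𝒜 h𝒜 hC => hC.isStandardType_of_eq h𝒜 (hp _) (hr _) (h2 _) (h2 _) h12⟩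
  by_cases h02 : a 0 = a 2
  · exact ⟨Equiv.swap 0 1, fun 𝒜 h𝒜 hC => hC.isStandardType_of_eq h𝒜 (hp _) (hr _) (h2 _) (h2 _)
      h02⟩
  by_cases h01 : a 0 = a 1
  · exact ⟨Equiv.swap 0 2, fun 𝒜 h𝒜 hC => hC.isStandardType_of_eq h𝒜 (hp _) (hr _) (h2 _) (h2 _)
      h01.symm⟩
  exact ⟨1, fun 𝒜 h𝒜 hC => hC.isStandardType_of_ne h𝒜 (hp _) (h2 _) (h2 _) (h2 _) h01 h02 h12⟩

theorem exists_isStandardType_pullback [IsAlgClosed F] [CharZero F] [Nontrivial Γ]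
    (h : IsGroupGrading 𝒜) (hs : Subgroup.closure (gradingSupport 𝒜) = ⊤) :
    ∃ f : SplitOctonion F ≃ₗ[F] SplitOctonion F, IsAlgAut f ∧ IsStandardType (pullback f 𝒜) := by
  by_cases hid : ∃ f : SplitOctonion F ≃ₗ[F] SplitOctonion F, IsAlgAut f ∧ e₁ F ∈ pullback f 𝒜 1
  · obtain ⟨f, hf, he⟩ := hid
    obtain ⟨a, ha, hπ⟩ := exists_isCartan (h.pullback hf) he
    have hcl : Subgroup.closure (Set.range a) = ⊤ := by
      obtain ⟨g, hg, hC⟩ := hπ 1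
      refine closure_eq_top_of_subset hs fun γ hγ => ?_
      rw [← gradingSupport_pullback f, ← gradingSupport_pullback g,
        hC.eq_cartanGrading ((h.pullback hf).pullback hg)] at hγ
      exact gradingSupport_cartanGrading _ hγ
    -- The ordering π is read off from the degrees alone, because the automorphism realising it is
    -- only chosen afterwards.
    obtain ⟨π, hstd⟩ := exists_perm_isStandardType (F := F) ha hcl
    obtain ⟨g, hg, hC⟩ := hπ π
    exact ⟨g.trans f, hg.trans hf, hstd _ ((h.pullback hf).pullback hg) hC⟩
  · push Not at hid
    obtain ⟨f, hf, h9⟩ := exists_isType9 h (fun x hx ht => eq_zero_of_no_idempotent h hid hx ht) hs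
    exact ⟨f, hf, .inr <| .inr <| .inr <| .inr <| .inr <| .inr <| .inr <| .inr h9⟩

/-! ### Uniqueness for elementary abelian 2-groups -/

section Uniqueness

variable {𝒟 ℬ : Γ → Submodule F (SplitOctonion F)}

omit [Finite Γ] [DecidableEq Γ]

theorem IsType7.gradingIsomorphic (h : IsType7 𝒟) (h' : IsType7 ℬ) : GradingIsomorphic 𝒟 ℬ := by
  obtain ⟨⟨φ⟩, g, hg, rfl⟩ := h
  obtain ⟨-, g', hg', rfl⟩ := h'
  have key : ∀ x y : Multiplicative (ZMod 2), x ≠ 1 → y ≠ 1 → x = y := by decide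
  have hne : ∀ x : Γ, orderOf x = 2 → φ x ≠ 1 := fun x hx hφ => by
    rw [(map_eq_one_iff φ φ.injective).1 hφ, orderOf_one] at hx
    omega
  obtain rfl := φ.injective (key _ _ (hne g hg) (hne g' hg'))
  simpa using gradingIsomorphic_ofComponents (MulEquiv.refl Γ)
    [(1, Submodule.span F {e₁ F, e₂ F, u₁ F, v₁ F}),
     (g, Submodule.span F {u₂ F, v₂ F, u₃ F, v₃ F})]

theorem ne_one_of_orderOf_eq_two {g : Γ} (hg : orderOf g = 2) : g ≠ 1 := by
  rintro rfl
  rw [orderOf_one] at hg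
  omega

theorem IsType8.gradingIsomorphic (hΓ : ∀ γ : Γ, γ * γ = 1) (h : IsType8 𝒟) (h' : IsType8 ℬ) :
    GradingIsomorphic 𝒟 ℬ := by
  obtain ⟨⟨ψ⟩, g, h, hg, hh, hgh, rfl⟩ := h
  obtain ⟨-, g', h', hg', hh', hgh', rfl⟩ := h'
  have hb : ∀ {x y : Γ}, orderOf x = 2 → orderOf y = 2 → x ≠ y →
      Function.Bijective (squareHom hΓ x y) := fun hx hy hxy => by
    have := Finite.of_equiv _ ψ.symm.toEquiv
    rw [Nat.bijective_iff_injective_and_card]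
    exact ⟨squareHom_injective hΓ (ne_one_of_orderOf_eq_two hx) (ne_one_of_orderOf_eq_two hy) hxy,
      Nat.card_congr ψ.symm.toEquiv⟩
  -- Both parameter pairs are bases of Γ over ℤ₂; φ⁻¹ followed by φ' is the automorphism of Γ
  -- carrying one to the other.
  obtain ⟨φ, rfl, rfl⟩ := exists_squareEquiv hΓ (hb hg hh hgh)
  obtain ⟨φ', rfl, rfl⟩ := exists_squareEquiv hΓ (hb hg' hh' hgh')
  simpa using gradingIsomorphic_ofComponents (φ.symm.trans φ')
    [(1, Submodule.span F {e₁ F, e₂ F}),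
     (φ (.ofAdd (1, 0)), Submodule.span F {u₁ F, v₁ F}),
     (φ (.ofAdd (0, 1)), Submodule.span F {u₂ F, v₂ F}),
     (φ (.ofAdd (1, 0)) * φ (.ofAdd (0, 1)), Submodule.span F {u₃ F, v₃ F})]

theorem IsType9.gradingIsomorphic (hΓ : ∀ γ : Γ, γ * γ = 1) (h : IsType9 𝒟) (h' : IsType9 ℬ) :
    GradingIsomorphic 𝒟 ℬ := by
  obtain ⟨⟨ψ⟩, g, h, k, -, -, -, hn, rfl⟩ := h
  obtain ⟨-, g', h', k', -, -, -, hn', rfl⟩ := h'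
  have hc : Nat.card Γ = 8 := by
    rw [Nat.card_congr ψ.toEquiv, Nat.card_congr Multiplicative.toAdd]; simp
  obtain ⟨φ, rfl, rfl, rfl⟩ := exists_cubeEquiv hΓ hc hn
  obtain ⟨φ', rfl, rfl, rfl⟩ := exists_cubeEquiv hΓ hc hn'
  have key := gradingIsomorphic_ofComponents (φ.symm.trans φ')
    [(1, Submodule.span F {1}),
     (φ (.ofAdd (0, 1, 0)), Submodule.span F {e₂ F - e₁ F}),
     (φ (.ofAdd (1, 0, 0)), Submodule.span F {v₁ F - u₁ F}),
     (φ (.ofAdd (0, 0, 1)), Submodule.span F {v₂ F - u₂ F}),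
     (φ (.ofAdd (1, 0, 0)) * φ (.ofAdd (0, 1, 0)), Submodule.span F {u₁ F + v₁ F}),
     (φ (.ofAdd (0, 1, 0)) * φ (.ofAdd (0, 0, 1)), Submodule.span F {u₂ F + v₂ F}),
     (φ (.ofAdd (1, 0, 0)) * φ (.ofAdd (0, 0, 1)), Submodule.span F {u₃ F + v₃ F}),
     (φ (.ofAdd (0, 1, 0)) * φ (.ofAdd (1, 0, 0)) * φ (.ofAdd (0, 0, 1)),
       Submodule.span F {v₃ F - u₃ F})]
  simpa only [List.map_cons, List.map_nil, map_one, map_mul, MulEquiv.trans_apply,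
    MulEquiv.symm_apply_apply] using key

/-- Over an elementary abelian `2`-group the order of the group determines the type. -/
theorem IsStandardType.of_exponent_two (hΓ : ∀ γ : Γ, γ * γ = 1) (h : IsStandardType 𝒟) :
    (Nat.card Γ = 2 ∧ IsType7 𝒟) ∨ (Nat.card Γ = 4 ∧ IsType8 𝒟) ∨
      (Nat.card Γ = 8 ∧ IsType9 𝒟) := by
  have ho : ∀ γ : Γ, orderOf γ ≤ 2 := fun γ =>
    orderOf_le_of_pow_eq_one two_pos (by rw [pow_two, hΓ])
  rcases h with h | h | h | h | h | h | h | h | h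
  · obtain ⟨g, -, hg, -⟩ := h
    exact absurd (ho g) (by omega)
  · obtain ⟨g, -, hg, -⟩ := h
    exact absurd (ho g) (by omega)
  · obtain ⟨g, hg, -⟩ := h
    exact absurd (ho g) (by omega)
  · obtain ⟨g, hg, -⟩ := h
    exact absurd (ho g) (by omega)
  · obtain ⟨-, g, hg, -⟩ := h
    exact absurd (ho g) (by omega)
  · obtain ⟨-, g, hg, -⟩ := h
    exact absurd (ho g) (by omega)
  · obtain ⟨φ⟩ := h.1
    exact .inl ⟨by rw [Nat.card_congr φ.toEquiv, Nat.card_congr Multiplicative.toAdd]; simp, h⟩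
  · obtain ⟨φ⟩ := h.1
    exact .inr (.inl
      ⟨by rw [Nat.card_congr φ.toEquiv, Nat.card_congr Multiplicative.toAdd]; simp, h⟩)
  · obtain ⟨φ⟩ := h.1
    exact .inr (.inr
      ⟨by rw [Nat.card_congr φ.toEquiv, Nat.card_congr Multiplicative.toAdd]; simp, h⟩)

/-- Two different types among 7, 8, 9 would give Γ two different orders, so only equal types need
comparing. -/
theorem IsStandardType.gradingIsomorphic (hΓ : ∀ γ : Γ, γ * γ = 1) (h : IsStandardType 𝒟)
    (h' : IsStandardType ℬ) : GradingIsomorphic 𝒟 ℬ := by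
  rcases h.of_exponent_two hΓ with ⟨c, h⟩ | ⟨c, h⟩ | ⟨c, h⟩ <;>
    rcases h'.of_exponent_two hΓ with ⟨c', h'⟩ | ⟨c', h'⟩ | ⟨c', h'⟩ <;>
    first
      | exact h.gradingIsomorphic h'
      | exact h.gradingIsomorphic hΓ h'
      | omega

end Uniqueness

end SplitOctonion

theorem theorem1 {F : Type*} [Field F] [IsAlgClosed F] [CharZero F]
    {Γ : Type*} [CommGroup Γ] [Finite Γ] [Nontrivial Γ] [DecidableEq Γ] :
    -- each of the listed families is a grading of the split octonions
    (∀ 𝒟 : Γ → Submodule F (SplitOctonion F),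
      SplitOctonion.IsStandardType 𝒟 → IsGroupGrading 𝒟) ∧
    -- every grading whose support generates the group is isomorphic to a listed one
    (∀ 𝒜 : Γ → Submodule F (SplitOctonion F), IsGroupGrading 𝒜 →
      Subgroup.closure (gradingSupport 𝒜) = ⊤ →
      ∃ 𝒟 : Γ → Submodule F (SplitOctonion F),
        SplitOctonion.IsStandardType 𝒟 ∧ GradingIsomorphic 𝒜 𝒟) ∧
    -- uniqueness up to isomorphism for elementary abelian 2-groups
    ((∀ γ : Γ, γ ^ 2 = 1) →
      ∀ 𝒜 ℬ : Γ → Submodule F (SplitOctonion F), IsGroupGrading 𝒜 → IsGroupGrading ℬ →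
        Subgroup.closure (gradingSupport 𝒜) = ⊤ → Subgroup.closure (gradingSupport ℬ) = ⊤ →
        GradingIsomorphic 𝒜 ℬ) := by
  refine ⟨fun 𝒟 h => h.isGroupGrading two_ne_zero, fun 𝒜 h𝒜 hs => ?_,
    fun hΓ 𝒜 ℬ h𝒜 hℬ hsA hsB => ?_⟩
  · obtain ⟨f, hf, h⟩ := SplitOctonion.exists_isStandardType_pullback h𝒜 hs
    exact ⟨_, h, gradingIsomorphic_pullback hf 𝒜⟩
  · have hΓ' : ∀ γ : Γ, γ * γ = 1 := fun γ => by rw [← pow_two, hΓ]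
    obtain ⟨f, hf, h⟩ := SplitOctonion.exists_isStandardType_pullback h𝒜 hsA
    obtain ⟨g, hg, h'⟩ := SplitOctonion.exists_isStandardType_pullback hℬ hsB
    exact ((gradingIsomorphic_pullback hf 𝒜).trans (h.gradingIsomorphic hΓ' h')).trans
      (gradingIsomorphic_pullback hg ℬ).symm
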